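/- Let $n\ge 0$, let $M$ be a smooth $(n+1)$-dimensional manifold and $\pi:M\to\mathbb R$ a surjective smooth submersion. Let $\pi_{10}:J^1\pi\to M$ be the first jet bundle of $\pi$, i.e. the affine subbundle $\{d\pi=1\}$ of $TM$, with the coordinates $(t,x^i,y^i)$ induced by fibred coordinates $(t,x^i)$ of $M$. Let $J=\frac{\partial}{\partial y^i}\otimes(dx^i-y^i\,dt)$ be the vertical endomorphism and, on forms, $d_J=i_J\circ d-d\circ i_J$, where $(i_J\omega)(X_1,\dots,X_k)=\sum_i\omega(X_1,\dots,JX_i,\dots,X_k)$. Let $S$ be a semispray: a smooth vector field on $J^1\pi$ with $J(S)=0$ and $dt(S)=1$. Let $W\subseteq J^1\pi$ be open. Denote by $\Lambda^1_S(W)$ the set of smooth $1$-forms $\theta$ on $W$ that are semi-basic (they vanish on $\ker D\pi_{10}$), non-degenerate ($d\theta+i_Sd\theta\wedge dt$ has rank $2n$ at every point of $W$) and satisfy $\mathcal L_Sd\theta=0$. For $L\in C^\infty(W)$ let $\theta_L=L\,dt+d_JL$ be its Poincaré–Cartan form; $L$ is a regular Lagrangian on $W$ if $d\theta_L$ has rank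 $2n$ at every point of $W$, and it is a regular Lagrangian for $S$ if moreover $\mathcal L_S\theta_L=dL$ on $W$. A first integral (conservation law) of $S$ on $W$ is an $f\in C^\infty(W)$ with $S(f)=0$. We say that $S$ is *Lagrangian on $W$* if it has a regular Lagrangian on $W$, and *conservative Lagrangian on $W$* if it has on $W$ a regular Lagrangian and a first integral $f$ with $df\not\equiv0$. We say that $S$ is a *Lagrangian vector field* if every point of $J^1\pi$ has an open neighbourhood on which $S$ is Lagrangian, and a *conservative Lagrangian vector field* if every $u\in J^1\pi$ has an open neighbourhood on which $S$ has a regular Lagrangian and a first integral $f$ such that $df$ does not vanish identically on any neighbourhood of $u$. **(i)** $S$ is a Lagrangian vector field if and only if every point of $J^1\pi$ has an open neighbourhood $W$ such that some $\theta\in\Lambda^1_S(W)$ satisfies $d_J\theta=0$. More precisely, for every open $W\subseteq J^1\pi$ (for instance $W=J^1\pi$), $S$ is Lagrangian on $W$ if and only if there is $\theta\in\Lambda^1_S(W)$ with $d_J\theta=0$. For every such $W$ and $\theta$ there is a regular Lagrangian $L$ on $W$ with $\theta=\theta_L$ and $\mathcal L_S\theta=dL$. **(ii)** $S$ is a conservative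 Lagrangian vector field if and only if every $u\in J^1\pi$ has an open neighbourhood $W$ such that for some $\theta\in\Lambda^1_S(W)$ the form $d_J\theta$ does not vanish identically on any neighbourhood of $u$. More precisely, let $W\subseteq J^1\pi$ be open. If $S$ is conservative Lagrangian on $W$, then there is $\theta\in\Lambda^1_S(W)$ with $d_J\theta\not\equiv0$; and if every closed $1$-form on $W$ is exact, then the converse holds as well. For every $\theta\in\Lambda^1_S(W)$ with $d_J\theta\not\equiv0$, every point of $W$ has an open neighbourhood $W'\subseteq W$ on which $$\theta=\theta_L+f\,dt$$ with a regular Lagrangian $L$ for $S$ on $W'$ and a first integral $f$ of $S$ on $W'$, where $df\not\equiv0$ on $W'$ if $d_J\theta\not\equiv0$ on $W'$; if every closed $1$-form on $W$ is exact, one can take $W'=W$. -/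

import Mathlib

open scoped Manifold ContDiff Topology
open Set Manifold

noncomputable section

section DifferentialForms

variable {E : Type*} [NormedAddCommGroup E] [NormedSpace ℝ E]
  {N : Type*} [TopologicalSpace N] [ChartedSpace E N] {k : ℕ}

variable (E N k) in
/-- Differential `k`-forms (not necessarily smooth) on a manifold `N` modelled on `E`. -/
abbrev DForm : Type _ := ∀ u : N, TangentSpace 𝓘(ℝ, E) u [⋀^Fin k]→L[ℝ] ℝ

variable (E N) in
/-- Vector fields (not necessarily smooth) on `N`. -/
abbrev VField : Type _ := ∀ u : N, TangentSpace 𝓘(ℝ, E) u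

variable (E N) in
/-- Fields of endomorphisms of the tangent spaces, i.e. `(1,1)`-tensor fields. -/
abbrev EndoField : Type _ := ∀ u : N, TangentSpace 𝓘(ℝ, E) u →L[ℝ] TangentSpace 𝓘(ℝ, E) u

namespace DForm

/-- The expression of a form in a chart `c`: its pullback under the inverse of `c`. -/
def inChart (c : OpenPartialHomeomorph N E) (η : DForm E N k) : E → E [⋀^Fin k]→L[ℝ] ℝ :=
  fun z => (η (c.symm z)).compContinuousLinearMap (mfderiv 𝓘(ℝ, E) 𝓘(ℝ, E) c.symm z)

/-- `η` is `C^∞` on the open set `W`: its coefficients are, in every chart of the atlas. -/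
def IsSmoothOn (η : DForm E N k) (W : Set N) : Prop :=
  ∀ c ∈ atlas E N, ContDiffOn ℝ ∞ (η.inChart c) (c.target ∩ c.symm ⁻¹' W)

/-- A function, as a `0`-form. -/
def ofFun (f : N → ℝ) : DForm E N 0 :=
  fun u => ContinuousAlternatingMap.constOfIsEmpty ℝ (TangentSpace 𝓘(ℝ, E) u) (Fin 0) (f u)

/-- The exterior derivative `dη`, computed at `u` in the preferred chart at `u`. -/
def extD (η : DForm E N k) : DForm E N (k + 1) := fun u =>
  (extDeriv (η.inChart (chartAt E u)) (chartAt E u u)).compContinuousLinearMap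
    (mfderiv 𝓘(ℝ, E) 𝓘(ℝ, E) (chartAt E u) u)

/-- The differential `df` of a function. -/
def differential (f : N → ℝ) : DForm E N 1 := extD (ofFun f)

/-- The inner product `i_X η` with a vector field (inserted in the first slot). -/
def interior (X : VField E N) (η : DForm E N (k + 1)) : DForm E N k := fun u =>
  ContinuousAlternatingMap.curryLeft (E := E) (η u) (X u)

/-- The Lie derivative `L_X = d ∘ i_X + i_X ∘ d` on forms of positive degree. -/
def lie (X : VField E N) (η : DForm E N (k + 1)) : DForm E N (k + 1) :=
  extD (interior X η) + interior X (extD η)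

/-- The value `θ(X)` of a `1`-form on a vector. -/
def eval (θ : DForm E N 1) (u : N) (v : TangentSpace 𝓘(ℝ, E) u) : ℝ := θ u (fun _ => v)

/-- For `A` linear: `(v₁, …, v_k) ↦ ∑ i, η (v₁, …, A vᵢ, …, v_k)`. -/
def derivationAux {V : Type*} [AddCommGroup V] [Module ℝ V] [TopologicalSpace V]
    (A : V →L[ℝ] V) (η : V [⋀^Fin k]→L[ℝ] ℝ) : V [⋀^Fin k]→L[ℝ] ℝ where
  toContinuousMultilinearMap := ∑ i, η.toContinuousMultilinearMap.compContinuousLinearMap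
    (fun j => if j = i then A else ContinuousLinearMap.id ℝ V)
  map_eq_zero_of_eq' := by
    intro v i j hij hne
    have hterm : ∀ l : Fin k, (η.toContinuousMultilinearMap.compContinuousLinearMap
        (fun m => if m = l then A else ContinuousLinearMap.id ℝ V)) v
          = η (Function.update v l (A (v l))) := by
      intro l
      refine congrArg η (funext fun m => ?_)
      by_cases hm : m = l
      · subst hm; simp
      · simp [hm]
    change (∑ l, η.toContinuousMultilinearMap.compContinuousLinearMap
      (fun m => if m = l then A else ContinuousLinearMap.id ℝ V)) v = 0
    rw [sum_apply, Finset.sum_congr rfl fun l _ => hterm l,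
      ← Finset.add_sum_erase _ _ (Finset.mem_univ i),
      ← Finset.add_sum_erase _ _ (Finset.mem_erase.2 ⟨hne.symm, Finset.mem_univ j⟩),
      Finset.sum_eq_zero, add_zero]
    · have hswap : Function.update v j (A (v j)) =
          Function.update v i (A (v i)) ∘ Equiv.swap i j := by
        funext m
        by_cases hmi : m = i
        · subst hmi; simp [hne, hne.symm, hij]
        · by_cases hmj : m = j
          · subst hmj; simp [hij]
          · simp [hmi, hmj, Equiv.swap_apply_of_ne_of_ne]
      rw [hswap]
      have h := η.toAlternatingMap.map_swap (Function.update v i (A (v i))) hne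
      exact (congrArg _ h).trans (add_neg_cancel _)
    · intro l hl
      simp only [Finset.mem_erase, Finset.mem_univ, and_true] at hl
      exact η.map_eq_zero_of_eq _ (by simp [hl.1.symm, hl.2.symm, hij]) hne

/-- The formula that `derivationAux` implements. -/
theorem derivationAux_apply {V : Type*} [AddCommGroup V] [Module ℝ V] [TopologicalSpace V]
    (A : V →L[ℝ] V) (η : V [⋀^Fin k]→L[ℝ] ℝ) (v : Fin k → V) :
    derivationAux A η v = ∑ i, η (Function.update v i (A (v i))) := by
  change (∑ l, η.toContinuousMultilinearMap.compContinuousLinearMap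
    (fun m => if m = l then A else ContinuousLinearMap.id ℝ V)) v = _
  rw [sum_apply]
  refine Finset.sum_congr rfl fun l _ => congrArg η (funext fun m => ?_)
  by_cases hm : m = l
  · subst hm; simp
  · simp [hm]

/-- The inner product `i_A η` with a `(1,1)`-tensor field,
`(i_A η)(X₁, …, X_k) = ∑ i, η (X₁, …, A Xᵢ, …, X_k)`; it is `0` on functions. -/
def insertion (A : EndoField E N) (η : DForm E N k) : DForm E N k :=
  fun u => derivationAux (A u) (η u)

/-- The exterior derivative `d_A = i_A ∘ d - d ∘ i_A` with respect to a `(1,1)`-tensor field. -/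
def dEndo (A : EndoField E N) (η : DForm E N k) : DForm E N (k + 1) :=
  insertion A (extD η) - extD (insertion A η)

/-- The wedge product of two covectors. -/
def wedgeAux (a b : E [⋀^Fin 1]→L[ℝ] ℝ) : E [⋀^Fin 2]→L[ℝ] ℝ :=
  ContinuousAlternatingMap.alternatizeUncurryFin
    (((ContinuousAlternatingMap.ofSubsingleton ℝ E ℝ (0 : Fin 1)).symm a).smulRight b)

/-- The formula that `wedgeAux` implements. -/
theorem wedgeAux_apply (a b : E [⋀^Fin 1]→L[ℝ] ℝ) (v : Fin 2 → E) :
    wedgeAux a b v = a (fun _ => v 0) * b (fun _ => v 1) - a (fun _ => v 1) * b (fun _ => v 0) := by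
  unfold wedgeAux
  rw [ContinuousAlternatingMap.alternatizeUncurryFin_apply, Fin.sum_univ_two]
  have h0 : (0 : Fin 2).removeNth v = fun _ => v 1 := by
    funext m; fin_cases m; rfl
  have h1 : (1 : Fin 2).removeNth v = fun _ => v 0 := by
    funext m; fin_cases m; rfl
  have h (x y : E) :
      (((ContinuousAlternatingMap.ofSubsingleton ℝ E ℝ (0 : Fin 1)).symm a).smulRight b) x
        (fun _ => y) = a (fun _ => x) * b (fun _ => y) := rfl
  rw [h0, h1, h, h]
  simp [sub_eq_add_neg]

/-- The wedge product `α ∧ β` of two `1`-forms. -/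
def wedge (α β : DForm E N 1) : DForm E N 2 := fun u => wedgeAux (E := E) (α u) (β u)

/-- The rank of a `2`-form at a point: the rank of the linear map `v ↦ i_v η`. -/
def rankAt (η : DForm E N 2) (u : N) : ℕ :=
  Module.finrank ℝ
    (LinearMap.range (ContinuousAlternatingMap.curryLeft (E := E) (η u)).toLinearMap)

end DForm

/-- Every smooth closed `1`-form on `W` is exact on `W` (the first de Rham cohomology of the
open set `W` vanishes). -/
def ClosedOneFormsExactOn (E : Type*) [NormedAddCommGroup E] [NormedSpace ℝ E]
    {N : Type*} [TopologicalSpace N] [ChartedSpace E N] (W : Set N) : Prop :=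
  ∀ α : DForm E N 1, α.IsSmoothOn W → (∀ u ∈ W, α.extD u = 0) →
    ∃ g : N → ℝ, ContMDiffOn 𝓘(ℝ, E) 𝓘(ℝ, ℝ) ∞ g W ∧ ∀ u ∈ W, α u = DForm.differential g u

end DifferentialForms

section JetBundle

/-- The model `ℝⁿ` of the fibres. -/
abbrev Rn (n : ℕ) : Type := EuclideanSpace ℝ (Fin n)

/-- The model space of the first jet bundle, with coordinates `((t, x), y)`. -/
abbrev JetModel (n : ℕ) : Type := (ℝ × Rn n) × Rn n

/-- The smooth `(n+1)`-dimensional manifold `M` is fibred over `ℝ` by `π`: `π` is a surjective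
smooth submersion. -/
class IsFibredOverReal (n : ℕ) {M : Type*} [TopologicalSpace M]
    [ChartedSpace (EuclideanSpace ℝ (Fin (n + 1))) M] [IsManifold (𝓡 (n + 1)) ∞ M]
    (π : M → ℝ) : Prop where
  submersion : IsSubmersion (𝓡 (n + 1)) 𝓘(ℝ, ℝ) ∞ π
  surjective : Function.Surjective π

/-- Fibred coordinates on `M`: a smooth chart `(t, x)` whose first coordinate is `t = π`. -/
structure FibredChart (n : ℕ) {M : Type*} [TopologicalSpace M]
    [ChartedSpace (EuclideanSpace ℝ (Fin (n + 1))) M] (π : M → ℝ) where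
  chart : OpenPartialHomeomorph M (ℝ × Rn n)
  smooth : ContMDiffOn (𝓡 (n + 1)) 𝓘(ℝ, ℝ × Rn n) ∞ chart chart.source
  smooth_symm : ContMDiffOn 𝓘(ℝ, ℝ × Rn n) (𝓡 (n + 1)) ∞ chart.symm chart.target
  fst_eq : ∀ x ∈ chart.source, (chart x).1 = π x

/-- The differential `dπ` at a point of `M`. -/
def timeDiff (n : ℕ) {M : Type*} [TopologicalSpace M]
    [ChartedSpace (EuclideanSpace ℝ (Fin (n + 1))) M] (π : M → ℝ) (x : M) :
    TangentSpace (𝓡 (n + 1)) x →L[ℝ] ℝ :=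
  mfderiv (𝓡 (n + 1)) 𝓘(ℝ, ℝ) π x

/-- The first jet bundle `J¹π`. The jet `j¹_t γ` of a local section `γ` of `π` is determined by
`γ(t)` and the velocity `γ'(t)`, which ranges over all tangent vectors `v` of `M` with `dπ(v) = 1`;
so `J¹π` is the affine subbundle `dπ = 1` of `TM`. -/
def J1 (n : ℕ) {M : Type*} [TopologicalSpace M]
    [ChartedSpace (EuclideanSpace ℝ (Fin (n + 1))) M] (π : M → ℝ) : Type _ :=
  {u : TangentBundle (𝓡 (n + 1)) M //
    timeDiff n π u.proj u.snd = 1}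

section Charts

variable {n : ℕ} {M : Type*} [TopologicalSpace M]
  [ChartedSpace (EuclideanSpace ℝ (Fin (n + 1))) M] {π : M → ℝ}

namespace J1

/-- The projection `π₁₀ : J¹π → M`. -/
def proj (u : J1 n π) : M := u.1.proj

/-- The velocity of a jet. -/
def velocity (u : J1 n π) : TangentSpace (𝓡 (n + 1)) u.proj := u.1.snd

end J1

namespace FibredChart

variable (e : FibredChart n π)

lemma mdiffAt {x : M} (hx : x ∈ e.chart.source) :
    MDifferentiableAt (𝓡 (n + 1)) 𝓘(ℝ, ℝ × Rn n) e.chart x :=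
  ((e.smooth x hx).contMDiffAt (e.chart.open_source.mem_nhds hx)).mdifferentiableAt (by simp)

lemma mdiffAt_symm {z : ℝ × Rn n} (hz : z ∈ e.chart.target) :
    MDifferentiableAt 𝓘(ℝ, ℝ × Rn n) (𝓡 (n + 1)) e.chart.symm z :=
  ((e.smooth_symm z hz).contMDiffAt (e.chart.open_target.mem_nhds hz)).mdifferentiableAt (by simp)

lemma mfderiv_fst {x : M} (hx : x ∈ e.chart.source) (v : TangentSpace (𝓡 (n + 1)) x) :
    (mfderiv (𝓡 (n + 1)) 𝓘(ℝ, ℝ × Rn n) e.chart x v : ℝ × Rn n).1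
      = timeDiff n π x v := by
  have h1 : π =ᶠ[𝓝 x] (fun p : ℝ × Rn n => p.1) ∘ e.chart := by
    filter_upwards [e.chart.open_source.mem_nhds hx] with y hy
    exact (e.fst_eq y hy).symm
  have h2 : HasMFDerivAt 𝓘(ℝ, ℝ × Rn n) 𝓘(ℝ, ℝ) (fun p : ℝ × Rn n => p.1) (e.chart x)
      (ContinuousLinearMap.fst ℝ ℝ (Rn n)) := hasFDerivAt_fst.hasMFDerivAt
  have h3 := (h2.comp x (e.mdiffAt hx).hasMFDerivAt).congr_of_eventuallyEq h1
  rw [timeDiff, h3.mfderiv]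
  rfl

lemma mfderiv_symm_mfderiv {x : M} (hx : x ∈ e.chart.source) (v : TangentSpace (𝓡 (n + 1)) x) :
    mfderiv 𝓘(ℝ, ℝ × Rn n) (𝓡 (n + 1)) e.chart.symm (e.chart x)
      (mfderiv (𝓡 (n + 1)) 𝓘(ℝ, ℝ × Rn n) e.chart x v) = v := by
  have h := HasMFDerivAt.comp x (e.mdiffAt_symm (e.chart.map_source hx)).hasMFDerivAt
    (e.mdiffAt hx).hasMFDerivAt
  have h1 : e.chart.symm ∘ e.chart =ᶠ[𝓝 x] id := by
    filter_upwards [e.chart.open_source.mem_nhds hx] with y hy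
    exact e.chart.left_inv hy
  have h2 := hasMFDerivAt_unique (h.congr_of_eventuallyEq h1.symm) (hasMFDerivAt_id x)
  exact congrArg (fun f => f v) h2

lemma mfderiv_mfderiv_symm {z : ℝ × Rn n} (hz : z ∈ e.chart.target) (w : ℝ × Rn n) :
    mfderiv (𝓡 (n + 1)) 𝓘(ℝ, ℝ × Rn n) e.chart (e.chart.symm z)
      (mfderiv 𝓘(ℝ, ℝ × Rn n) (𝓡 (n + 1)) e.chart.symm z w) = w := by
  have h := HasMFDerivAt.comp z (e.mdiffAt (e.chart.map_target hz)).hasMFDerivAt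
    (e.mdiffAt_symm hz).hasMFDerivAt
  have h1 : e.chart ∘ e.chart.symm =ᶠ[𝓝 z] id := by
    filter_upwards [e.chart.open_target.mem_nhds hz] with y hy
    exact e.chart.right_inv hy
  have h2 := hasMFDerivAt_unique (h.congr_of_eventuallyEq h1.symm) (hasMFDerivAt_id z)
  exact congrArg (fun f => f w) h2

lemma mfderiv_symm_one {z : ℝ × Rn n} (hz : z ∈ e.chart.target) (y : Rn n) :
    timeDiff n π (e.chart.symm z)
      (mfderiv 𝓘(ℝ, ℝ × Rn n) (𝓡 (n + 1)) e.chart.symm z ((1, y) : ℝ × Rn n)) = 1 := by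
  have h := e.mfderiv_fst (e.chart.map_target hz)
    (mfderiv 𝓘(ℝ, ℝ × Rn n) (𝓡 (n + 1)) e.chart.symm z ((1, y) : ℝ × Rn n))
  rw [e.mfderiv_mfderiv_symm hz] at h
  exact h.symm

/-- The jet with coordinates `p = ((t, x), y)`: the velocity is `∂/∂t + yⁱ ∂/∂xⁱ`. -/
def jetOfCoord (p : JetModel n) (hp : p.1 ∈ e.chart.target) : J1 n π :=
  ⟨⟨e.chart.symm p.1, mfderiv 𝓘(ℝ, ℝ × Rn n) (𝓡 (n + 1)) e.chart.symm p.1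
    ((1, p.2) : ℝ × Rn n)⟩, e.mfderiv_symm_one hp p.2⟩

open Classical in
/-- `jetOfCoord`, extended by the junk value `u₀` outside the range of the chart. -/
def jetInv (u₀ : J1 n π) (p : JetModel n) : J1 n π :=
  if hp : p.1 ∈ e.chart.target then e.jetOfCoord p hp else u₀

lemma jetInv_of_mem (u₀ : J1 n π) {p : JetModel n} (hp : p.1 ∈ e.chart.target) :
    e.jetInv u₀ p = e.jetOfCoord p hp := dif_pos hp

end FibredChart

variable [IsManifold (𝓡 (n + 1)) ∞ M]

/-- `J¹π` carries the topology of a subspace of `TM`. -/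
instance J1.instTopologicalSpace (π : M → ℝ) : TopologicalSpace (J1 n π) :=
  inferInstanceAs (TopologicalSpace {u : TangentBundle (𝓡 (n + 1)) M //
    timeDiff n π u.proj u.snd = 1})

/-- The chart `(t, x, y)` of `J¹π` induced by the fibred chart `(t, x)` of `M`. -/
def FibredChart.jetChart (e : FibredChart n π) (u₀ : J1 n π) : OpenPartialHomeomorph (J1 n π) (JetModel n) where
  toFun u := (e.chart u.proj,
    (mfderiv (𝓡 (n + 1)) 𝓘(ℝ, ℝ × Rn n) e.chart u.proj u.velocity : ℝ × Rn n).2)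
  invFun := e.jetInv u₀
  source := {u | u.proj ∈ e.chart.source}
  target := {p | p.1 ∈ e.chart.target}
  map_source' u hu := e.chart.map_source hu
  map_target' p hp := by
    have hp' : p.1 ∈ e.chart.target := hp
    rw [e.jetInv_of_mem u₀ hp']
    exact e.chart.map_target hp'
  left_inv' u hu := by
    obtain ⟨⟨x, v⟩, huv⟩ := u
    have hx : x ∈ e.chart.source := hu
    have hp' : e.chart x ∈ e.chart.target := e.chart.map_source hx
    have h1 : ((1, (mfderiv (𝓡 (n + 1)) 𝓘(ℝ, ℝ × Rn n) e.chart x v : ℝ × Rn n).2) : ℝ × Rn n)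
        = (mfderiv (𝓡 (n + 1)) 𝓘(ℝ, ℝ × Rn n) e.chart x v : ℝ × Rn n) :=
      Prod.ext ((e.mfderiv_fst hx v).trans huv).symm rfl
    refine (e.jetInv_of_mem u₀ (p := (e.chart x, _)) hp').trans (Subtype.ext ?_)
    change (⟨e.chart.symm (e.chart x), mfderiv 𝓘(ℝ, ℝ × Rn n) (𝓡 (n + 1)) e.chart.symm (e.chart x)
      ((1, (mfderiv (𝓡 (n + 1)) 𝓘(ℝ, ℝ × Rn n) e.chart x v : ℝ × Rn n).2) : ℝ × Rn n)⟩ :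
        TangentBundle (𝓡 (n + 1)) M) = ⟨x, v⟩
    rw [h1]
    have h2 := e.mfderiv_symm_mfderiv hx v
    refine Bundle.TotalSpace.ext (e.chart.left_inv hx) (heq_of_eq h2)
  right_inv' p hp := by
    have hp' : p.1 ∈ e.chart.target := hp
    rw [e.jetInv_of_mem u₀ hp']
    refine Prod.ext (e.chart.right_inv hp') ?_
    have h := congrArg Prod.snd (e.mfderiv_mfderiv_symm hp' ((1, p.2) : ℝ × Rn n))
    exact h
  open_source := by
    have : Continuous (fun u : J1 n π => u.proj) :=
      (FiberBundle.continuous_proj _ (TangentSpace (𝓡 (n + 1)))).comp continuous_subtype_val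
    exact e.chart.open_source.preimage this
  open_target := e.chart.open_target.preimage continuous_fst
  continuousOn_toFun := by
    have h := e.smooth.continuousOn_tangentMapWithin (by simp) e.chart.open_source.uniqueMDiffOn
    have h2 : ContinuousOn (fun u : J1 n π => tangentBundleModelSpaceHomeomorph 𝓘(ℝ, ℝ × Rn n)
        (tangentMapWithin (𝓡 (n + 1)) 𝓘(ℝ, ℝ × Rn n) e.chart e.chart.source u.1))
        {u | u.proj ∈ e.chart.source} :=
      (tangentBundleModelSpaceHomeomorph 𝓘(ℝ, ℝ × Rn n)).continuous.comp_continuousOn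
        (h.comp continuous_subtype_val.continuousOn (fun u hu => hu))
    have h3 : ContinuousOn (fun u : J1 n π => ((e.chart u.proj,
        (mfderiv (𝓡 (n + 1)) 𝓘(ℝ, ℝ × Rn n) e.chart u.proj u.velocity : ℝ × Rn n)) :
          (ℝ × Rn n) × (ℝ × Rn n))) {u | u.proj ∈ e.chart.source} := by
      refine ContinuousOn.congr h2 ?_
      intro u hu
      have hu' : u.1.proj ∈ e.chart.source := hu
      have := mfderivWithin_of_isOpen (I := 𝓡 (n + 1)) (I' := 𝓘(ℝ, ℝ × Rn n)) (f := e.chart)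
        e.chart.open_source hu'
      simp only [tangentMapWithin, this]
      rfl
    exact h3.fst.prodMk h3.snd.snd
  continuousOn_invFun := by
    refine (Topology.IsInducing.subtypeVal.continuousOn_iff).2 ?_
    have h := e.smooth_symm.continuousOn_tangentMapWithin (by simp)
      e.chart.open_target.uniqueMDiffOn
    have h2 : ContinuousOn (fun p : JetModel n => 
        (tangentMapWithin 𝓘(ℝ, ℝ × Rn n) (𝓡 (n + 1)) e.chart.symm e.chart.target
        ((tangentBundleModelSpaceHomeomorph 𝓘(ℝ, ℝ × Rn n)).symm (p.1, ((1, p.2) : ℝ × Rn n)))))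
        {p | p.1 ∈ e.chart.target} := by
      refine h.comp (t := _ ) ?_ (fun u hu => hu)
      refine ((tangentBundleModelSpaceHomeomorph 𝓘(ℝ, ℝ × Rn n)).symm.continuous.comp ?_).continuousOn
      exact (continuous_fst.prodMk (continuous_const.prodMk continuous_snd))
    refine h2.congr ?_
    intro p hp
    have hp' : p.1 ∈ e.chart.target := hp
    have := mfderivWithin_of_isOpen (I' := 𝓡 (n + 1)) (I := 𝓘(ℝ, ℝ × Rn n)) (f := e.chart.symm)
        e.chart.open_target hp'
    refine (congrArg Subtype.val (e.jetInv_of_mem u₀ hp')).trans ?_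
    refine Bundle.TotalSpace.ext rfl (heq_of_eq ?_)
    change _ = mfderivWithin 𝓘(ℝ, ℝ × Rn n) (𝓡 (n + 1)) e.chart.symm e.chart.target p.1 _
    rw [this]
    rfl


/-- Fibred charts exist around every point. -/
theorem exists_fibredChart (π : M → ℝ) [hπ : IsFibredOverReal n π] (x : M) :
    ∃ e : FibredChart n π, x ∈ e.chart.source := by
  obtain ⟨F, _, _, hF⟩ := hπ.submersion
  have h := hF x
  have hfin : FiniteDimensional ℝ (ℝ × F) := h.equiv.toLinearEquiv.finiteDimensional
  have hfinF : FiniteDimensional ℝ F := 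
    Module.Finite.of_surjective (LinearMap.snd ℝ ℝ F) LinearMap.snd_surjective
  have hrank : Module.finrank ℝ F = Module.finrank ℝ (Rn n) := by
    have := h.equiv.toLinearEquiv.finrank_eq
    rw [Module.finrank_prod] at this
    simp at this
    simp
    omega
  let L : F ≃L[ℝ] Rn n := ContinuousLinearEquiv.ofFinrankEq hrank
  let A : EuclideanSpace ℝ (Fin (n + 1)) ≃L[ℝ] ℝ × Rn n :=
    h.equiv.trans ((ContinuousLinearEquiv.refl ℝ ℝ).prodCongr L)
  let c : OpenPartialHomeomorph (ℝ × Rn n) (ℝ × Rn n) :=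
    h.codChart.symm.prod (OpenPartialHomeomorph.refl (Rn n))
  let e : OpenPartialHomeomorph M (ℝ × Rn n) :=
    (h.domChart.trans A.toHomeomorph.toOpenPartialHomeomorph).trans c
  have hsrc : ∀ y ∈ h.domChart.source, (A (h.domChart y)).1 = h.codChart (π y) := by
    intro y hy
    have := h.writtenInCharts (show h.domChart y ∈ (h.domChart.extend (𝓡 (n + 1))).target by
      simp [hy])
    simp [hy] at this
    simp [A, this]
  have hsource : e.source = h.domChart.source := by
    ext y
    simp only [e, c, OpenPartialHomeomorph.trans_source]
    simp
    intro hy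
    rw [hsrc y hy]
    exact h.codChart.map_source (h.source_subset_preimage_source hy)
  have hdc : ContMDiffOn 𝓘(ℝ, ℝ) 𝓘(ℝ, ℝ) ∞ h.codChart.symm h.codChart.target := 
    contMDiffOn_symm_of_mem_maximalAtlas h.codChart_mem_maximalAtlas
  have hdc' : ContMDiffOn 𝓘(ℝ, ℝ) 𝓘(ℝ, ℝ) ∞ h.codChart h.codChart.source := 
    contMDiffOn_of_mem_maximalAtlas h.codChart_mem_maximalAtlas
  have hd : ContMDiffOn (𝓡 (n + 1)) (𝓡 (n + 1)) ∞ h.domChart h.domChart.source := 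
    contMDiffOn_of_mem_maximalAtlas h.domChart_mem_maximalAtlas
  have hd' : ContMDiffOn (𝓡 (n + 1)) (𝓡 (n + 1)) ∞ h.domChart.symm h.domChart.target := 
    contMDiffOn_symm_of_mem_maximalAtlas h.domChart_mem_maximalAtlas
  have hc : ContMDiffOn 𝓘(ℝ, ℝ × Rn n) 𝓘(ℝ, ℝ × Rn n) ∞ c c.source := by
    rw [contMDiffOn_iff_contDiffOn] at *
    have h1 : ContDiffOn ℝ ∞ (fun p : ℝ × Rn n => (h.codChart.symm p.1, p.2)) c.source :=
      (hdc.comp contDiffOn_fst (fun p hp => hp.1)).prodMk contDiffOn_snd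
    exact h1
  have hc' : ContMDiffOn 𝓘(ℝ, ℝ × Rn n) 𝓘(ℝ, ℝ × Rn n) ∞ c.symm c.target := by
    rw [contMDiffOn_iff_contDiffOn] at *
    have h1 : ContDiffOn ℝ ∞ (fun p : ℝ × Rn n => (h.codChart p.1, p.2)) c.target :=
      (hdc'.comp contDiffOn_fst (fun p hp => hp.1)).prodMk contDiffOn_snd
    exact h1
  refine ⟨⟨e, ?_, ?_, ?_⟩, ?_⟩
  · have hA := A.contDiff.contMDiff (n := ∞)
    refine hc.comp (t := c.source) ((hA.comp_contMDiffOn hd).mono hsource.le) ?_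
    intro y hy
    exact hy.2
  · have hA := A.symm.contDiff.contMDiff (n := ∞)
    refine hd'.comp (t := h.domChart.target) (hA.comp_contMDiffOn (hc'.mono ?_)) ?_
    · intro y hy
      exact hy.1
    · intro y hy
      have := hy.2
      simpa using this
  · intro y hy
    have hy' := hsource ▸ hy
    change h.codChart.symm (A (h.domChart y)).1 = _
    rw [hsrc y hy']
    exact h.codChart.left_inv (h.source_subset_preimage_source hy')
  · rw [hsource]; exact h.mem_domChart_source

variable [IsFibredOverReal n π]

/-- `J¹π` is a manifold, with the charts induced by the fibred charts of `M`. -/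
instance J1.instChartedSpace : ChartedSpace (JetModel n) (J1 n π) where
  atlas := {c | ∃ (e : FibredChart n π) (u₀ : J1 n π), c = e.jetChart u₀}
  chartAt u := (exists_fibredChart π u.proj).choose.jetChart u
  mem_chart_source u := (exists_fibredChart π u.proj).choose_spec
  chart_mem_atlas u := ⟨_, u, rfl⟩

/-- `J¹π` is a smooth manifold. -/
instance J1.instIsManifold : IsManifold 𝓘(ℝ, JetModel n) ∞ (J1 n π) := by
  apply isManifold_of_contDiffOn
  rintro _ _ ⟨e, u, rfl⟩ ⟨e', u', rfl⟩
  simp only [modelWithCornersSelf_coe, modelWithCornersSelf_coe_symm, Function.id_comp, 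
    Function.comp_id, Set.range_id, Set.inter_univ, Set.preimage_id]
  set s : Set (ℝ × Rn n) := e.chart.target ∩ e.chart.symm ⁻¹' e'.chart.source with hs
  have hso : IsOpen s := e.chart.symm.isOpen_inter_preimage e'.chart.open_source
  have hsm : ContDiffOn ℝ ∞ (e'.chart ∘ e.chart.symm) s := by
    rw [← contMDiffOn_iff_contDiffOn]
    exact e'.smooth.comp (e.smooth_symm.mono inter_subset_left) (fun z hz => hz.2)
  have hfd : ContDiffOn ℝ ∞ (fun p : JetModel n => 
      ((e'.chart (e.chart.symm p.1)), 
        (fderiv ℝ (e'.chart ∘ e.chart.symm) p.1 ((1, p.2) : ℝ × Rn n)).2)) {p | p.1 ∈ s} := by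
    have h1 : ContDiffOn ℝ ∞ (fderiv ℝ (e'.chart ∘ e.chart.symm)) s :=
      hsm.fderiv_of_isOpen hso (by simp)
    have h2 : ContDiffOn ℝ ∞ (fun p : JetModel n => fderiv ℝ (e'.chart ∘ e.chart.symm) p.1) 
      {p | p.1 ∈ s} := h1.comp contDiffOn_fst (fun p hp => hp)
    have h3 : ContDiffOn ℝ ∞ (fun p : JetModel n => e'.chart (e.chart.symm p.1))
      {p | p.1 ∈ s} := hsm.comp contDiffOn_fst (fun p hp => hp)
    exact h3.prodMk (h2.clm_apply (contDiffOn_const.prodMk contDiffOn_snd)).snd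
  have hsub : ∀ p ∈ ((e.jetChart u).symm.trans (e'.jetChart u')).source, p.1 ∈ s := by
    intro p hp
    have hp1 : p.1 ∈ e.chart.target := hp.1
    have hp2 : ((e.jetChart u).symm p).proj ∈ e'.chart.source := hp.2
    refine ⟨hp1, ?_⟩
    have : ((e.jetChart u).symm p).proj = e.chart.symm p.1 := by
      exact congrArg J1.proj (e.jetInv_of_mem u hp1)
    rw [this] at hp2
    exact hp2
  refine (hfd.mono hsub).congr ?_
  intro p hp
  obtain ⟨hp1, hp2⟩ := hsub p hp
  have h1 : (e.jetChart u).symm p = e.jetOfCoord p hp1 := e.jetInv_of_mem u hp1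
  have h2 : fderiv ℝ (e'.chart ∘ e.chart.symm) p.1 = 
      (mfderiv (𝓡 (n + 1)) 𝓘(ℝ, ℝ × Rn n) e'.chart (e.chart.symm p.1)).comp 
        (mfderiv 𝓘(ℝ, ℝ × Rn n) (𝓡 (n + 1)) e.chart.symm p.1) := by
    rw [← mfderiv_eq_fderiv]
    exact mfderiv_comp p.1 (e'.mdiffAt hp2) (e.mdiffAt_symm hp1)
  simp only [OpenPartialHomeomorph.coe_trans, Function.comp_apply, h1, h2]
  rfl

end Charts

end JetBundle

section Mechanics

variable {n : ℕ} {M : Type*} [TopologicalSpace M]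
  [ChartedSpace (EuclideanSpace ℝ (Fin (n + 1))) M] [IsManifold (𝓡 (n + 1)) ∞ M]
  {π : M → ℝ} [IsFibredOverReal n π]

/-- The `1`-form `dt` on `J¹π`, the differential of `π ∘ π₁₀`. -/
def dtForm (n : ℕ) {M : Type*} [TopologicalSpace M]
    [ChartedSpace (EuclideanSpace ℝ (Fin (n + 1))) M] [IsManifold (𝓡 (n + 1)) ∞ M]
    (π : M → ℝ) [IsFibredOverReal n π] : DForm (JetModel n) (J1 n π) 1 :=
  DForm.differential fun u => π u.proj

/-- The matrix of `∂/∂yⁱ ⊗ (dxⁱ - yⁱ dt)` in the coordinates `((t, x), y)`, i.e. the map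
`((τ, ξ), ζ) ↦ ((0, 0), ξ - τ y)`. -/
def verticalEndoCoord {n : ℕ} (y : Rn n) : JetModel n →L[ℝ] JetModel n :=
  (ContinuousLinearMap.inr ℝ (ℝ × Rn n) (Rn n)).comp
    ((ContinuousLinearMap.snd ℝ ℝ (Rn n) - (ContinuousLinearMap.fst ℝ ℝ (Rn n)).smulRight y).comp
      (ContinuousLinearMap.fst ℝ (ℝ × Rn n) (Rn n)))

/-- The vertical endomorphism `J = ∂/∂yⁱ ⊗ (dxⁱ - yⁱ dt)`. -/
def verticalEndo (n : ℕ) {M : Type*} [TopologicalSpace M]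
    [ChartedSpace (EuclideanSpace ℝ (Fin (n + 1))) M] [IsManifold (𝓡 (n + 1)) ∞ M]
    (π : M → ℝ) [IsFibredOverReal n π] : EndoField (JetModel n) (J1 n π) := fun u =>
  (mfderiv 𝓘(ℝ, JetModel n) 𝓘(ℝ, JetModel n) (chartAt (JetModel n) u).symm
      (chartAt (JetModel n) u u)).comp
    ((verticalEndoCoord (chartAt (JetModel n) u u).2).comp
      (mfderiv 𝓘(ℝ, JetModel n) 𝓘(ℝ, JetModel n) (chartAt (JetModel n) u) u))

/-- The derivation `d_J` defined by the vertical endomorphism. -/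
def dJ {k : ℕ} (η : DForm (JetModel n) (J1 n π) k) : DForm (JetModel n) (J1 n π) (k + 1) :=
  DForm.dEndo (verticalEndo n π) η

/-- A semispray: a smooth vector field `S` on `J¹π` with `J(S) = 0` and `dt(S) = 1`. -/
structure IsSemispray (S : VField (JetModel n) (J1 n π)) : Prop where
  smooth : ContMDiff 𝓘(ℝ, JetModel n) 𝓘(ℝ, JetModel n).tangent ∞
    (fun u => (⟨u, S u⟩ : TangentBundle 𝓘(ℝ, JetModel n) (J1 n π)))
  vertical : ∀ u, verticalEndo n π u (S u) = 0
  time : ∀ u, (dtForm n π).eval u (S u) = 1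

/-- A `1`-form is semi-basic on `W` if it vanishes on the vertical vectors, those in the kernel
of the differential of `π₁₀`. -/
def IsSemibasicOn (θ : DForm (JetModel n) (J1 n π) 1) (W : Set (J1 n π)) : Prop :=
  ∀ u ∈ W, ∀ v : TangentSpace 𝓘(ℝ, JetModel n) u,
    mfderiv 𝓘(ℝ, JetModel n) (𝓡 (n + 1)) (J1.proj : J1 n π → M) u v = 0 → θ.eval u v = 0

/-- `θ` is non-degenerate on `W`: the `2`-form `dθ + i_S dθ ∧ dt` has rank `2n` there. -/
def IsNondegenerateOn (S : VField (JetModel n) (J1 n π)) (θ : DForm (JetModel n) (J1 n π) 1)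
    (W : Set (J1 n π)) : Prop :=
  ∀ u ∈ W, (θ.extD + (DForm.interior S θ.extD).wedge (dtForm n π)).rankAt u = 2 * n

/-- The set `Λ¹_S(W)` of the smooth, semi-basic, non-degenerate `1`-forms `θ` on the open set `W`
with `L_S dθ = 0`. -/
def LambdaS (S : VField (JetModel n) (J1 n π)) (W : Set (J1 n π)) :
    Set (DForm (JetModel n) (J1 n π) 1) :=
  {θ | θ.IsSmoothOn W ∧ IsSemibasicOn θ W ∧ IsNondegenerateOn S θ W ∧
    ∀ u ∈ W, DForm.lie S θ.extD u = 0}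

/-- The form `f dt`. -/
def smulDt (f : J1 n π → ℝ) : DForm (JetModel n) (J1 n π) 1 := fun u => f u • dtForm n π u

/-- The Poincaré-Cartan `1`-form `θ_L = L dt + d_J L`. -/
def poincareCartan (L : J1 n π → ℝ) : DForm (JetModel n) (J1 n π) 1 :=
  smulDt L + dJ (DForm.ofFun L)

/-- `L` is a regular Lagrangian on the open set `W`: it is smooth and `dθ_L` has rank `2n`. -/
def IsRegularLagrangianOn (L : J1 n π → ℝ) (W : Set (J1 n π)) : Prop :=
  ContMDiffOn 𝓘(ℝ, JetModel n) 𝓘(ℝ, ℝ) ∞ L W ∧ ∀ u ∈ W, (poincareCartan L).extD.rankAt u = 2 * n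

/-- `L` is, on `W`, a regular Lagrangian for `S`: moreover `L_S θ_L = dL`. -/
def IsLagrangianFor (S : VField (JetModel n) (J1 n π)) (L : J1 n π → ℝ) (W : Set (J1 n π)) :
    Prop :=
  IsRegularLagrangianOn L W ∧
    ∀ u ∈ W, DForm.lie S (poincareCartan L) u = DForm.differential L u

/-- `f` is a first integral (conservation law) of `S` on the open set `W`: `S(f) = 0`. -/
def IsFirstIntegralOn (S : VField (JetModel n) (J1 n π)) (f : J1 n π → ℝ) (W : Set (J1 n π)) :
    Prop :=
  ContMDiffOn 𝓘(ℝ, JetModel n) 𝓘(ℝ, ℝ) ∞ f W ∧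
    ∀ u ∈ W, (DForm.differential f).eval u (S u) = 0

/-- `S` has a regular Lagrangian that is defined on the whole open set `W`. -/
def IsLagrangianOn (S : VField (JetModel n) (J1 n π)) (W : Set (J1 n π)) : Prop :=
  ∃ L, IsLagrangianFor S L W

/-- `S` is a Lagrangian vector field: around every point it has a locally defined regular
Lagrangian. -/
def IsLagrangian (S : VField (JetModel n) (J1 n π)) : Prop :=
  ∀ u, ∃ W, IsOpen W ∧ u ∈ W ∧ IsLagrangianOn S W

/-- `S` has, on the whole open set `W`, a regular Lagrangian and a first integral that is not
locally constant. -/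
def IsConservativeLagrangianOn (S : VField (JetModel n) (J1 n π)) (W : Set (J1 n π)) : Prop :=
  ∃ L f, IsLagrangianFor S L W ∧ IsFirstIntegralOn S f W ∧
    ∃ u ∈ W, (DForm.differential f : DForm (JetModel n) (J1 n π) 1) u ≠ 0

/-- `S` is a conservative Lagrangian vector field: around every point `u` it has a locally defined
regular Lagrangian and a locally defined first integral that is non-constant near `u`. -/
def IsConservativeLagrangian (S : VField (JetModel n) (J1 n π)) : Prop :=
  ∀ u, ∃ W, IsOpen W ∧ u ∈ W ∧ ∃ L f, IsLagrangianFor S L W ∧ IsFirstIntegralOn S f W ∧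
    ∃ᶠ v in 𝓝 u, (DForm.differential f : DForm (JetModel n) (J1 n π) 1) v ≠ 0

/-- On `W` one has `θ = θ_L + f dt` with a regular Lagrangian `L` for `S` and a first integral
`f` of `S`, and `f` is not locally constant if `d_J θ` does not vanish identically. -/
def HasLagrangianDecompositionOn (S : VField (JetModel n) (J1 n π))
    (θ : DForm (JetModel n) (J1 n π) 1) (W : Set (J1 n π)) : Prop :=
  ∃ L f, IsLagrangianFor S L W ∧ IsFirstIntegralOn S f W ∧
    (∀ u ∈ W, θ u = (poincareCartan L + smulDt f : DForm (JetModel n) (J1 n π) 1) u) ∧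
    ((∃ u ∈ W, dJ θ u ≠ 0) →
      ∃ u ∈ W, (DForm.differential f : DForm (JetModel n) (J1 n π) 1) u ≠ 0)

end Mechanics

end

/-! Let `θ` be semi-basic and `A = θ(S)`. Since `S = ∂/∂t + yⁱ ∂/∂xⁱ + Gⁱ ∂/∂yⁱ` in jet coordinates,
differentiating `θ(S)` in vertical directions recovers the `dx`-components of `θ`, up to a term in
`i_S dθ`: one gets `θ = A dt + dA ∘ J + (i_S dθ) ∘ J` (`semibasic_eval_eq`).

If moreover `L_S dθ = 0`, then `d² = 0` makes `i_S dθ` closed. Given a primitive `g`, the identity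
becomes `θ = θ_L + f dt` with `L = A + g` and `f = -g` (`exists_decomposition`). Taking exterior
derivatives, `dθ_L = dθ + i_S dθ ∧ dt`. So non-degeneracy of `θ` is regularity of `L`; contracting
with `S` gives `i_S dθ_L = 0`, which is `L_S θ_L = dL` because `θ_L(S) = L`; and `S(f) = -dθ(S, S) =
0`. The same computation backwards shows that a regular Lagrangian for `S` and a first integral `f`
give `θ_L + f dt ∈ Λ¹_S(W)`, with `i_S d(θ_L + f dt) = -df` (`poincareCartan_add_smulDt_mem`).

It remains to detect from `d_J θ` whether `df` vanishes. On an open set, `d_J θ = 0` if and only if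
`i_S dθ = 0` (`dJ_eq_zero_iff`). For one direction, `d_J θ = i_J dθ` evaluated on `S` and `Y` is
`dθ(S, JY)`; its vanishing makes `i_S dθ` semi-basic. This form is also closed and kills `S`, and
`semibasic_eval_eq`, applied to it, shows that it is zero. For the other, `i_S dθ = 0` gives `θ =
θ_A`, and `d_J θ_A = 0` because `dθ_A(JX, Y)` is the second derivative of `A` along `JX` and `JY`,
which is symmetric (`dJ_poincareCartan`).

In (i) the function `g = 0` is a primitive, so no condition on `W` enters. In (ii) the primitive
comes from the Poincaré lemma locally, and from exactness of closed `1`-forms globally. -/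

/-! ### Expressions in charts and chart independence of the exterior derivative -/

section ChartCalculus

variable {E : Type*} [NormedAddCommGroup E] [NormedSpace ℝ E]
  {N : Type*} [TopologicalSpace N] [ChartedSpace E N] {k : ℕ}

/-- The expression of a vector field in a chart. -/
noncomputable def VField.inChart (c : OpenPartialHomeomorph N E) (X : VField E N) : E → E :=
  fun z => mfderiv 𝓘(ℝ, E) 𝓘(ℝ, E) c (c.symm z) (X (c.symm z))

lemma extDeriv_one_apply {α : E → E [⋀^Fin 1]→L[ℝ] ℝ} {z : E} (v w : E) :
    extDeriv α z ![v, w] = fderiv ℝ α z v (fun _ => w) - fderiv ℝ α z w (fun _ => v) := by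
  rw [extDeriv, ContinuousAlternatingMap.alternatizeUncurryFin_apply, Fin.sum_univ_two]
  have h0 : (0 : Fin 2).removeNth ![v, w] = fun _ => w := by
    funext m; fin_cases m; rfl
  have h1 : (1 : Fin 2).removeNth ![v, w] = fun _ => v := by
    funext m; fin_cases m; rfl
  rw [h0, h1]
  simp [sub_eq_add_neg]

lemma extDeriv_zero_apply (f : E → ℝ) {z : E} (w : Fin 1 → E) :
    extDeriv (fun x => ContinuousAlternatingMap.constOfIsEmpty ℝ E (Fin 0) (f x)) z w
      = fderiv ℝ f z (w 0) := by
  rw [extDeriv_constOfIsEmpty]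
  rfl

namespace DForm

lemma inChart_apply (c : OpenPartialHomeomorph N E) (η : DForm E N k) (z : E) (v : Fin k → E) :
    η.inChart c z v = η (c.symm z) (fun i => mfderiv 𝓘(ℝ, E) 𝓘(ℝ, E) c.symm z (v i)) := rfl

lemma IsSmoothOn.contDiffAt {η : DForm E N k} {W : Set N} (hη : η.IsSmoothOn W) (hW : IsOpen W)
    {c : OpenPartialHomeomorph N E} (hc : c ∈ atlas E N) {z : E} (hz : z ∈ c.target)
    (hzW : c.symm z ∈ W) : ContDiffAt ℝ ∞ (η.inChart c) z :=
  (hη c hc).contDiffAt ((c.symm.isOpen_inter_preimage hW).mem_nhds ⟨hz, hzW⟩)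

end DForm

/-- The order of smoothness required by the pullback rule for `extDeriv`, by `d ∘ d = 0` and by the
symmetry of second derivatives. -/
lemma minSmoothness_two_le_infty : minSmoothness ℝ 2 ≤ (∞ : WithTop ℕ∞) := by
  rw [minSmoothness_of_isRCLikeNormedField]
  exact WithTop.coe_le_coe.2 le_top

variable [IsManifold 𝓘(ℝ, E) ∞ N]

lemma mdifferentiable_of_mem_atlas_infty {c : OpenPartialHomeomorph N E} (hc : c ∈ atlas E N) :
    c.MDifferentiable 𝓘(ℝ, E) 𝓘(ℝ, E) :=
  haveI : IsManifold 𝓘(ℝ, E) 1 N := IsManifold.of_le (n := ∞) (by simp)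
  mdifferentiable_of_mem_atlas hc

lemma mfderiv_symm_mfderiv_of_mem_atlas {c : OpenPartialHomeomorph N E} (hc : c ∈ atlas E N)
    {u : N} (hu : u ∈ c.source) (v : TangentSpace 𝓘(ℝ, E) u) :
    mfderiv 𝓘(ℝ, E) 𝓘(ℝ, E) c.symm (c u) (mfderiv 𝓘(ℝ, E) 𝓘(ℝ, E) c u v) = v :=
  DFunLike.congr_fun ((mdifferentiable_of_mem_atlas_infty hc).symm_comp_deriv hu) v

lemma mfderiv_mfderiv_symm_of_mem_atlas {c : OpenPartialHomeomorph N E} (hc : c ∈ atlas E N)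
    {z : E} (hz : z ∈ c.target) (v : E) :
    mfderiv 𝓘(ℝ, E) 𝓘(ℝ, E) c (c.symm z) (mfderiv 𝓘(ℝ, E) 𝓘(ℝ, E) c.symm z v) = v :=
  DFunLike.congr_fun ((mdifferentiable_of_mem_atlas_infty hc).comp_symm_deriv hz) v

/-- The transition between two charts of the atlas is smooth. -/
lemma contDiffAt_transition {c c' : OpenPartialHomeomorph N E} (hc : c ∈ atlas E N)
    (hc' : c' ∈ atlas E N) {z : E} (hz : z ∈ c.target) (hz' : c.symm z ∈ c'.source) :
    ContDiffAt ℝ ∞ (c' ∘ c.symm) z := by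
  have h1 := contMDiffOn_symm_of_mem_maximalAtlas (I := 𝓘(ℝ, E)) (n := ∞)
    (IsManifold.subset_maximalAtlas hc)
  have h2 := contMDiffOn_of_mem_maximalAtlas (I := 𝓘(ℝ, E)) (n := ∞)
    (IsManifold.subset_maximalAtlas hc')
  rw [← contMDiffAt_iff_contDiffAt]
  exact (h2.contMDiffAt (c'.open_source.mem_nhds hz')).comp z
    (h1.contMDiffAt (c.open_target.mem_nhds hz))

lemma fderiv_transition {c c' : OpenPartialHomeomorph N E} (hc : c ∈ atlas E N)
    (hc' : c' ∈ atlas E N) {z : E} (hz : z ∈ c.target) (hz' : c.symm z ∈ c'.source) (v : E) :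
    fderiv ℝ (c' ∘ c.symm) z v = mfderiv 𝓘(ℝ, E) 𝓘(ℝ, E) c' (c.symm z)
      (mfderiv 𝓘(ℝ, E) 𝓘(ℝ, E) c.symm z v) := by
  rw [← mfderiv_eq_fderiv]
  exact DFunLike.congr_fun
    (mfderiv_comp z ((mdifferentiable_of_mem_atlas_infty hc').mdifferentiableAt hz')
      ((mdifferentiable_of_mem_atlas_infty hc).mdifferentiableAt_symm hz)) v

namespace DForm

/-- The expressions in two charts are related by pullback under the transition map. -/
lemma inChart_transition (η : DForm E N k) {c c' : OpenPartialHomeomorph N E}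
    (hc : c ∈ atlas E N) (hc' : c' ∈ atlas E N) {z : E} (hz : z ∈ c.target)
    (hz' : c.symm z ∈ c'.source) :
    η.inChart c z = (η.inChart c' ((c' ∘ c.symm) z)).compContinuousLinearMap
      (fderiv ℝ (c' ∘ c.symm) z) := by
  ext v
  rw [ContinuousAlternatingMap.compContinuousLinearMap_apply, inChart_apply, inChart_apply]
  -- Every tangent space is the model space `E` by definition, so values of `η` at two equal but
  -- syntactically different points can be compared on the same vectors.
  have key : ∀ (u u' : N) (_ : u' = u) (w : Fin k → E), η u w = η u' w := by
    rintro u _ rfl w; rfl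
  have h := c'.left_inv hz'
  exact (key _ _ h _).trans (congrArg (η (c'.symm (c' (c.symm z)))) (funext fun i =>
    ((congrArg (mfderiv 𝓘(ℝ, E) 𝓘(ℝ, E) c'.symm (c' (c.symm z)))
      (fderiv_transition hc hc' hz hz' (v i))).trans
        (mfderiv_symm_mfderiv_of_mem_atlas hc' hz' _)).symm))

/-- The exterior derivative can be computed in any chart of the atlas. -/
lemma extD_inChart {η : DForm E N k} {W : Set N} (hW : IsOpen W) (hη : η.IsSmoothOn W)
    {c : OpenPartialHomeomorph N E} (hc : c ∈ atlas E N) {z : E} (hz : z ∈ c.target)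
    (hzW : c.symm z ∈ W) : η.extD.inChart c z = extDeriv (η.inChart c) z := by
  -- `extD` at `c.symm z` is defined through this chart, so the claim is that `d` commutes with
  -- pullback under the transition from `c` to `c'`.
  set c' := chartAt E (c.symm z) with hc'_def
  have hc' : c' ∈ atlas E N := chart_mem_atlas E _
  have hz' : c.symm z ∈ c'.source := mem_chart_source E _
  have hev : η.inChart c =ᶠ[𝓝 z] fun w =>
      (η.inChart c' ((c' ∘ c.symm) w)).compContinuousLinearMap (fderiv ℝ (c' ∘ c.symm) w) := by
    filter_upwards [(c.symm.isOpen_inter_preimage c'.open_source).mem_nhds ⟨hz, hz'⟩] with w hw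
    exact η.inChart_transition hc hc' hw.1 hw.2
  have hd : DifferentiableAt ℝ (η.inChart c') ((c' ∘ c.symm) z) := by
    refine (hη.contDiffAt hW hc' (c'.map_source hz') ?_).differentiableAt (by simp)
    rwa [c'.left_inv hz']
  rw [hev.extDeriv_eq, extDeriv_pullback hd (contDiffAt_transition hc hc' hz hz')
    minSmoothness_two_le_infty]
  ext v
  rw [ContinuousAlternatingMap.compContinuousLinearMap_apply, inChart_apply]
  refine congrArg (extDeriv (η.inChart c') (c' (c.symm z))) (funext fun i => ?_)
  exact (fderiv_transition hc hc' hz hz' (v i)).symm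

end DForm

end ChartCalculus

/-! ### Calculus of forms on a manifold: locality, smoothness, `d ∘ d = 0`, Poincaré lemma -/

section FormCalculus

variable {E : Type*} [NormedAddCommGroup E] [NormedSpace ℝ E]
  {N : Type*} [TopologicalSpace N] [ChartedSpace E N] {k : ℕ}

namespace DForm

/-- The exterior derivative is local. -/
lemma extD_congr {η η' : DForm E N k} {W : Set N} (hW : IsOpen W) (h : ∀ u ∈ W, η u = η' u)
    {u : N} (hu : u ∈ W) : η.extD u = η'.extD u := by
  have hev : η.inChart (chartAt E u) =ᶠ[𝓝 (chartAt E u u)] η'.inChart (chartAt E u) := by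
    have hu' : u ∈ (chartAt E u).source := mem_chart_source E u
    filter_upwards [((chartAt E u).symm.isOpen_inter_preimage hW).mem_nhds
      ⟨(chartAt E u).map_source hu', by
        change (chartAt E u).symm (chartAt E u u) ∈ W
        rwa [(chartAt E u).left_inv hu']⟩] with w hw
    unfold inChart
    rw [h _ hw.2]
  unfold extD
  rw [hev.extDeriv_eq]

lemma IsSmoothOn.mono {η : DForm E N k} {W W' : Set N} (hη : η.IsSmoothOn W)
    (h : W' ⊆ W) : η.IsSmoothOn W' :=
  fun c hc => (hη c hc).mono (inter_subset_inter_right _ (preimage_mono h))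

lemma IsSmoothOn.add {η η' : DForm E N k} {W : Set N} (hη : η.IsSmoothOn W)
    (hη' : η'.IsSmoothOn W) : (η + η').IsSmoothOn W :=
  fun c hc => (hη c hc).add (hη' c hc)

lemma extD_zero : (0 : DForm E N k).extD = 0 := by
  funext u
  have h : (0 : DForm E N k).inChart (chartAt E u) = fun _ => 0 := rfl
  unfold extD
  have h0 : extDeriv (fun _ : E => (0 : E [⋀^Fin k]→L[ℝ] ℝ)) (chartAt E u u) = 0 := by
    rw [extDeriv, fderiv_const_apply]
    exact map_zero (ContinuousAlternatingMap.alternatizeUncurryFinCLM ℝ E ℝ)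
  rw [h, h0]
  rfl

lemma interior_apply (X : VField E N) (η : DForm E N (k + 1)) (u : N)
    (v : Fin k → TangentSpace 𝓘(ℝ, E) u) : interior X η u v = η u (Matrix.vecCons (X u) v) := rfl

lemma eval_add (θ θ' : DForm E N 1) (u : N) (v : TangentSpace 𝓘(ℝ, E) u) :
    (θ + θ').eval u v = θ.eval u v + θ'.eval u v := rfl

/-- Lets the smoothness of `θ(S)` be deduced from that of contractions of forms. -/
lemma interior_eq_ofFun (X : VField E N) (θ : DForm E N 1) :
    interior X θ = ofFun fun u => θ.eval u (X u) := by
  funext u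
  ext v
  rw [interior_apply]
  exact congrArg (θ u) (funext fun i => by fin_cases i; rfl)

lemma ext_one {θ θ' : DForm E N 1} {u : N}
    (h : ∀ v : TangentSpace 𝓘(ℝ, E) u, θ.eval u v = θ'.eval u v) : θ u = θ' u := by
  ext v
  have hv : v = fun _ => v 0 := funext fun i => by fin_cases i; rfl
  rw [hv]
  exact h (v 0)

lemma ext_two {η η' : DForm E N 2} {u : N}
    (h : ∀ v w : TangentSpace 𝓘(ℝ, E) u, η u ![v, w] = η' u ![v, w]) : η u = η' u := by
  ext v
  have hv : v = ![v 0, v 1] := funext fun i => by fin_cases i <;> rfl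
  rw [hv]
  exact h (v 0) (v 1)

lemma eval_map_zero (θ : DForm E N 1) (u : N) : θ.eval u 0 = 0 :=
  map_zero ((ContinuousAlternatingMap.ofSubsingleton ℝ (TangentSpace 𝓘(ℝ, E) u) ℝ
    (0 : Fin 1)).symm (θ u))

lemma wedge_apply (α β : DForm E N 1) (u : N) (v w : TangentSpace 𝓘(ℝ, E) u) :
    α.wedge β u ![v, w] = α.eval u v * β.eval u w - α.eval u w * β.eval u v :=
  wedgeAux_apply (E := E) (α u) (β u) ![v, w]

lemma insertion_one_eval (A : EndoField E N) (θ : DForm E N 1) (u : N)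
    (v : TangentSpace 𝓘(ℝ, E) u) : (insertion A θ).eval u v = θ.eval u (A u v) := by
  unfold eval insertion
  rw [derivationAux_apply, Fin.sum_univ_one]
  exact congrArg (θ u) (funext fun i => by fin_cases i; rfl)

lemma insertion_two_apply (A : EndoField E N) (η : DForm E N 2) (u : N)
    (v w : TangentSpace 𝓘(ℝ, E) u) :
    insertion A η u ![v, w] = η u ![A u v, w] + η u ![v, A u w] := by
  unfold insertion
  rw [derivationAux_apply, Fin.sum_univ_two]
  refine congrArg₂ (· + ·) ?_ ?_ <;>
    exact congrArg (η u) (funext fun i => by fin_cases i <;> rfl)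

lemma insertion_ofFun (A : EndoField E N) (f : N → ℝ) :
    insertion A (ofFun f : DForm E N 0) = 0 := by
  funext u
  ext v
  unfold insertion
  rw [derivationAux_apply]
  rfl

/-- As `i_A` kills functions, only `df ∘ A` survives in `d_A f`. -/
lemma dEndo_ofFun (A : EndoField E N) (f : N → ℝ) :
    dEndo A (ofFun f : DForm E N 0) = insertion A (differential f) := by
  unfold dEndo
  rw [insertion_ofFun, extD_zero, sub_zero]
  rfl

lemma two_swap (η : DForm E N 2) (u : N) (v w : TangentSpace 𝓘(ℝ, E) u) :
    η u ![v, w] = - η u ![w, v] := by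
  have h := (η u).toAlternatingMap.map_swap ![w, v] (i := 0) (j := 1) (by decide)
  have h2 : ![w, v] ∘ Equiv.swap (0 : Fin 2) 1 = ![v, w] := by
    funext i; fin_cases i <;> simp
  rw [h2] at h
  exact h

lemma ofFun_inChart (f : N → ℝ) (c : OpenPartialHomeomorph N E) :
    (ofFun f : DForm E N 0).inChart c =
      fun z => ContinuousAlternatingMap.constOfIsEmpty ℝ E (Fin 0) (f (c.symm z)) := rfl

lemma interior_inChart_eval (X : VField E N) (η : DForm E N (k + 1))
    {c : OpenPartialHomeomorph N E} {z : E}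
    (hX : mfderiv 𝓘(ℝ, E) 𝓘(ℝ, E) c.symm z (X.inChart c z : E) = X (c.symm z)) :
    (interior X η).inChart c z = (η.inChart c z).curryLeft (X.inChart c z) := by
  ext v
  rw [inChart_apply, interior_apply, ContinuousAlternatingMap.curryLeft_apply_apply, inChart_apply]
  refine congrArg (η (c.symm z)) (funext fun i => ?_)
  refine Fin.cases ?_ (fun j => rfl) i
  exact hX.symm

lemma extD_add {η η' : DForm E N k} {W : Set N} (hW : IsOpen W) (hη : η.IsSmoothOn W)
    (hη' : η'.IsSmoothOn W) {u : N} (hu : u ∈ W) :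
    (η + η').extD u = η.extD u + η'.extD u := by
  have hus : u ∈ (chartAt E u).source := mem_chart_source E u
  have hd : ∀ ζ : DForm E N k, ζ.IsSmoothOn W →
      DifferentiableAt ℝ (ζ.inChart (chartAt E u)) (chartAt E u u) := fun ζ hζ =>
    (hζ.contDiffAt hW (chart_mem_atlas E u) ((chartAt E u).map_source hus)
      (by rwa [(chartAt E u).left_inv hus])).differentiableAt (by simp)
  have h : (η + η').inChart (chartAt E u)
    = η.inChart (chartAt E u) + η'.inChart (chartAt E u) := rfl
  unfold DForm.extD
  rw [h, extDeriv_add (hd _ hη) (hd _ hη')]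
  rfl

variable [IsManifold 𝓘(ℝ, E) ∞ N]

/-- The value of a form, from its expression in a chart. -/
lemma apply_eq_inChart (η : DForm E N k) {c : OpenPartialHomeomorph N E} (hc : c ∈ atlas E N)
    {u : N} (hu : u ∈ c.source) (v : Fin k → TangentSpace 𝓘(ℝ, E) u) :
    η u v = η.inChart c (c u) (fun i => mfderiv 𝓘(ℝ, E) 𝓘(ℝ, E) c u (v i)) := by
  have key : ∀ (u u' : N) (_ : u' = u) (w : Fin k → E), η u w = η u' w := by
    rintro u _ rfl w; rfl
  exact (congrArg (η u) (funext fun i => (mfderiv_symm_mfderiv_of_mem_atlas hc hu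
    (v i)).symm)).trans (key _ _ (c.left_inv hu) _)

lemma eq_of_inChart_eq {η η' : DForm E N k} {c : OpenPartialHomeomorph N E} (hc : c ∈ atlas E N)
    {u : N} (hu : u ∈ c.source) (h : η.inChart c (c u) = η'.inChart c (c u)) : η u = η' u := by
  ext v
  rw [apply_eq_inChart η hc hu, apply_eq_inChart η' hc hu, h]

lemma isSmoothOn_ofFun {f : N → ℝ} {W : Set N} (hf : ContMDiffOn 𝓘(ℝ, E) 𝓘(ℝ, ℝ) ∞ f W) :
    (ofFun f : DForm E N 0).IsSmoothOn W := by
  intro c hc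
  have h1 := contMDiffOn_symm_of_mem_maximalAtlas (I := 𝓘(ℝ, E)) (n := ∞)
    (IsManifold.subset_maximalAtlas hc)
  have h2 : ContDiffOn ℝ ∞ (f ∘ c.symm) (c.target ∩ c.symm ⁻¹' W) := by
    rw [← contMDiffOn_iff_contDiffOn]
    exact hf.comp (h1.mono inter_subset_left) fun z hz => hz.2
  exact (ContinuousAlternatingMap.constOfIsEmptyLIE ℝ E ℝ (Fin 0)).contDiff.comp_contDiffOn h2

/-- Functions such as `θ(S)` and the time coordinate are most easily checked to be smooth in charts,
as `0`-forms; this turns the check into smoothness on the manifold. -/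
lemma contMDiffOn_of_isSmoothOn_ofFun {f : N → ℝ} {W : Set N} (hW : IsOpen W)
    (hf : (ofFun f : DForm E N 0).IsSmoothOn W) : ContMDiffOn 𝓘(ℝ, E) 𝓘(ℝ, ℝ) ∞ f W := by
  intro u hu
  have hc := chart_mem_atlas E u
  have hus : u ∈ (chartAt E u).source := mem_chart_source E u
  have h1 : ContDiffAt ℝ ∞ (f ∘ (chartAt E u).symm) (chartAt E u u) := by
    have h := hf.contDiffAt hW hc ((chartAt E u).map_source hus)
      (by rwa [(chartAt E u).left_inv hus])
    exact (ContinuousAlternatingMap.constOfIsEmptyLIE ℝ E ℝ (Fin 0)).symm.contDiff.contDiffAt.comp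
      _ h
  have h2 := (contMDiffOn_of_mem_maximalAtlas (I := 𝓘(ℝ, E)) (n := ∞)
    (IsManifold.subset_maximalAtlas hc)).contMDiffAt ((chartAt E u).open_source.mem_nhds hus)
  refine ((h1.contMDiffAt.comp u h2).congr_of_eventuallyEq ?_).contMDiffWithinAt
  filter_upwards [(chartAt E u).open_source.mem_nhds hus] with v hv
  simp [(chartAt E u).left_inv hv]

lemma IsSmoothOn.extD {η : DForm E N k} {W : Set N} (hW : IsOpen W) (hη : η.IsSmoothOn W) :
    η.extD.IsSmoothOn W := by
  intro c hc
  have ho : IsOpen (c.target ∩ c.symm ⁻¹' W) := c.symm.isOpen_inter_preimage hW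
  have h1 : ContDiffOn ℝ ∞ (fderiv ℝ (η.inChart c)) (c.target ∩ c.symm ⁻¹' W) :=
    (hη c hc).fderiv_of_isOpen ho (by simp)
  refine ((ContinuousAlternatingMap.alternatizeUncurryFinCLM ℝ E ℝ).contDiff.comp_contDiffOn
    h1).congr fun z hz => ?_
  exact extD_inChart hW hη hc hz.1 hz.2

/-- `d ∘ d = 0`. -/
lemma extD_extD {η : DForm E N k} {W : Set N} (hW : IsOpen W) (hη : η.IsSmoothOn W)
    {u : N} (hu : u ∈ W) : η.extD.extD u = 0 := by
  have hus : u ∈ (chartAt E u).source := mem_chart_source E u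
  have hut := (chartAt E u).map_source hus
  have huW : (chartAt E u).symm (chartAt E u u) ∈ W := by rwa [(chartAt E u).left_inv hus]
  have hc := chart_mem_atlas E u
  have hev : η.extD.inChart (chartAt E u) =ᶠ[𝓝 (chartAt E u u)]
      extDeriv (η.inChart (chartAt E u)) := by
    filter_upwards [((chartAt E u).symm.isOpen_inter_preimage hW).mem_nhds ⟨hut, huW⟩] with w hw
    exact extD_inChart hW hη hc hw.1 hw.2
  refine eq_of_inChart_eq (η' := 0) hc hus ?_
  rw [extD_inChart hW (hη.extD hW) hc hut huW, hev.extDeriv_eq,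
    extDeriv_extDeriv_apply (hη.contDiffAt hW hc hut huW) minSmoothness_two_le_infty]
  rfl

lemma isSmoothOn_differential {f : N → ℝ} {W : Set N} (hW : IsOpen W)
    (hf : ContMDiffOn 𝓘(ℝ, E) 𝓘(ℝ, ℝ) ∞ f W) : (differential f : DForm E N 1).IsSmoothOn W :=
  (isSmoothOn_ofFun hf).extD hW

lemma differential_inChart_apply {f : N → ℝ} {W : Set N} (hW : IsOpen W)
    (hf : ContMDiffOn 𝓘(ℝ, E) 𝓘(ℝ, ℝ) ∞ f W) {c : OpenPartialHomeomorph N E}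
    (hc : c ∈ atlas E N) {z : E} (hz : z ∈ c.target) (hzW : c.symm z ∈ W) (w : Fin 1 → E) :
    (differential f : DForm E N 1).inChart c z w = fderiv ℝ (f ∘ c.symm) z (w 0) := by
  unfold differential
  rw [extD_inChart hW (isSmoothOn_ofFun hf) hc hz hzW, ofFun_inChart]
  exact extDeriv_zero_apply (f ∘ c.symm) w

lemma mfderiv_symm_inChart (X : VField E N) {c : OpenPartialHomeomorph N E} (hc : c ∈ atlas E N)
    {z : E} (hz : z ∈ c.target) :
    mfderiv 𝓘(ℝ, E) 𝓘(ℝ, E) c.symm z (X.inChart c z : E) = X (c.symm z) := by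
  have h := mfderiv_symm_mfderiv_of_mem_atlas hc (c.map_target hz) (X (c.symm z))
  rw [c.right_inv hz] at h
  exact h

lemma interior_inChart (X : VField E N) (η : DForm E N (k + 1)) {c : OpenPartialHomeomorph N E}
    (hc : c ∈ atlas E N) {z : E} (hz : z ∈ c.target) :
    (interior X η).inChart c z = (η.inChart c z).curryLeft (X.inChart c z) :=
  interior_inChart_eval X η (mfderiv_symm_inChart X hc hz)

/-- A smooth vector field has smooth components in the charts of the atlas. -/
lemma contDiffOn_inChart_of_contMDiff {X : VField E N}
    (hX : ContMDiff 𝓘(ℝ, E) 𝓘(ℝ, E).tangent ∞ (fun u => (⟨u, X u⟩ : TangentBundle 𝓘(ℝ, E) N)))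
    {c : OpenPartialHomeomorph N E} (hc : c ∈ atlas E N) :
    ContDiffOn ℝ ∞ (X.inChart c) c.target := by
  have h1 := contMDiffOn_symm_of_mem_maximalAtlas (I := 𝓘(ℝ, E)) (n := ∞)
    (IsManifold.subset_maximalAtlas hc)
  have h2 := contMDiffOn_of_mem_maximalAtlas (I := 𝓘(ℝ, E)) (n := ∞)
    (IsManifold.subset_maximalAtlas hc)
  have : IsManifold 𝓘(ℝ, E) 1 N := IsManifold.of_le (n := ∞) (by simp)
  have h3 := h2.contMDiffOn_tangentMapWithin (m := ∞) (by simp) c.open_source.uniqueMDiffOn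
  have h4 := (contMDiff_snd_tangentBundle_modelSpace (n := ∞) E 𝓘(ℝ, E)).comp_contMDiffOn
    (h3.comp (hX.comp_contMDiffOn h1) fun z hz => c.map_target hz)
  rw [contMDiffOn_iff_contDiffOn] at h4
  refine h4.congr fun z hz => ?_
  have := mfderivWithin_of_isOpen (I := 𝓘(ℝ, E)) (I' := 𝓘(ℝ, E)) (f := c)
    c.open_source (c.map_target hz)
  exact (DFunLike.congr_fun this (X (c.symm z))).symm

lemma IsSmoothOn.interior {X : VField E N}
    (hX : ContMDiff 𝓘(ℝ, E) 𝓘(ℝ, E).tangent ∞ (fun u => (⟨u, X u⟩ : TangentBundle 𝓘(ℝ, E) N)))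
    {η : DForm E N (k + 1)} {W : Set N} (hη : η.IsSmoothOn W) :
    (interior X η).IsSmoothOn W := by
  intro c hc
  have h1 := (contDiffOn_inChart_of_contMDiff hX hc).mono
    (inter_subset_left (t := c.symm ⁻¹' W))
  let cl : (E [⋀^Fin (k + 1)]→L[ℝ] ℝ) →L[ℝ] (E →L[ℝ] E [⋀^Fin k]→L[ℝ] ℝ) :=
    ContinuousAlternatingMap.curryLeftLI.toContinuousLinearMap
  have hcl : ContDiff ℝ ∞ (fun ζ => cl ζ) := by fun_prop
  have h2 := hcl.comp_contDiffOn (hη c hc)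
  refine (h2.clm_apply h1).congr fun z hz => ?_
  exact interior_inChart X η hc hz.1

/-- The Poincaré lemma for `1`-forms. -/
lemma exists_local_primitive {α : DForm E N 1} {W : Set N} (hW : IsOpen W) (hα : α.IsSmoothOn W)
    (hclosed : ∀ u ∈ W, α.extD u = 0) {u : N} (hu : u ∈ W) :
    ∃ W' : Set N, IsOpen W' ∧ u ∈ W' ∧ W' ⊆ W ∧ ∃ g : N → ℝ,
      ContMDiffOn 𝓘(ℝ, E) 𝓘(ℝ, ℝ) ∞ g W' ∧ ∀ v ∈ W', α v = differential g v := by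
  set c := chartAt E u with hc_def
  have hc : c ∈ atlas E N := chart_mem_atlas E u
  have hus : u ∈ c.source := mem_chart_source E u
  have ho : IsOpen (c.target ∩ c.symm ⁻¹' W) := c.symm.isOpen_inter_preimage hW
  -- A ball in the chart image of `W` is convex, hence a domain where closed forms can be
  -- integrated.
  obtain ⟨r, hr, hball⟩ := Metric.isOpen_iff.1 ho (c u) ⟨c.map_source hus, by
    change c.symm (c u) ∈ W
    rwa [c.left_inv hus]⟩
  let a : E → E →L[ℝ] ℝ := fun z =>
    (ContinuousAlternatingMap.ofSubsingletonLIE (𝕜 := ℝ) (E := E) (F := ℝ) (0 : Fin 1)).symm (α.inChart c z)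
  have ha : ContDiffOn ℝ ∞ a (Metric.ball (c u) r) :=
    (ContinuousAlternatingMap.ofSubsingletonLIE (𝕜 := ℝ) (E := E) (F := ℝ)
      (0 : Fin 1)).symm.contDiff.comp_contDiffOn ((hα c hc).mono hball)
  have hda : ∀ z ∈ Metric.ball (c u) r, ∀ v w,
      fderiv ℝ a z v w = fderiv ℝ (α.inChart c) z v (fun _ => w) := by
    intro z hz v w
    have hd := ((hα.contDiffAt hW hc (hball hz).1 (hball hz).2).differentiableAt
      (by simp)).hasFDerivAt
    have h := ((ContinuousAlternatingMap.ofSubsingletonLIE (𝕜 := ℝ) (E := E) (F := ℝ)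
      (0 : Fin 1)).symm.toContinuousLinearEquiv.toContinuousLinearMap.hasFDerivAt
        (x := α.inChart c z)).comp z hd
    rw [HasFDerivAt.fderiv (f := a) h]
    rfl
  -- Closedness of `α` says that the derivative of the covector field `a` is symmetric, which is the
  -- integrability condition for `a = dG`.
  obtain ⟨G, hG⟩ := (convex_ball (c u) r).exists_forall_hasFDerivAt_of_fderiv_symmetric
    Metric.isOpen_ball (ha.differentiableOn (by simp)) (by
      intro z hz v w
      have h1 := extD_inChart hW hα hc (hball hz).1 (hball hz).2
      have h2 : α.extD.inChart c z = 0 := by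
        unfold inChart
        rw [hclosed _ (hball hz).2]
        rfl
      have h3 := extDeriv_one_apply (α := α.inChart c) (z := z) v w
      rw [← h1, h2] at h3
      rw [hda z hz, hda z hz]
      exact (sub_eq_zero.1 h3.symm))
  -- So far `G` is only differentiable; it is smooth because its derivative `a` is.
  have hGs : ContDiffOn ℝ ∞ G (Metric.ball (c u) r) := by
    rw [contDiffOn_infty_iff_fderiv_of_isOpen Metric.isOpen_ball]
    exact ⟨fun z hz => (hG z hz).differentiableAt.differentiableWithinAt,
      ha.congr fun z hz => (hG z hz).fderiv⟩
  have hW' : IsOpen (c.source ∩ c ⁻¹' Metric.ball (c u) r) :=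
    c.isOpen_inter_preimage Metric.isOpen_ball
  have hgs : ContMDiffOn 𝓘(ℝ, E) 𝓘(ℝ, ℝ) ∞ (G ∘ c) (c.source ∩ c ⁻¹' Metric.ball (c u) r) :=
    hGs.contMDiffOn.comp ((contMDiffOn_of_mem_maximalAtlas (I := 𝓘(ℝ, E)) (n := ∞)
      (IsManifold.subset_maximalAtlas hc)).mono inter_subset_left) fun v hv => hv.2
  refine ⟨_, hW', ⟨hus, Metric.mem_ball_self hr⟩, ?_, G ∘ c, hgs, ?_⟩
  · rintro v ⟨hv, hv'⟩
    have := (hball hv').2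
    change c.symm (c v) ∈ W at this
    rwa [c.left_inv hv] at this
  · rintro v ⟨hv, hv'⟩
    refine eq_of_inChart_eq hc hv ?_
    ext w
    rw [differential_inChart_apply hW' hgs hc (c.map_source hv)
      (by rw [c.left_inv hv]; exact ⟨hv, hv'⟩)]
    have hev : (G ∘ c) ∘ c.symm =ᶠ[𝓝 (c v)] G := by
      filter_upwards [c.open_target.mem_nhds (c.map_source hv)] with z hz
      simp [c.right_inv hz]
    rw [hev.fderiv_eq, (hG _ hv').fderiv]
    have hw : w = fun _ => w 0 := funext fun i => by fin_cases i; rfl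
    conv_lhs => rw [hw]
    rfl

end DForm

end FormCalculus

/-! ### Jet charts: `dt`, the vertical endomorphism and semisprays in coordinates -/

section JetCharts

variable {n : ℕ} {M : Type*} [TopologicalSpace M]
  [ChartedSpace (EuclideanSpace ℝ (Fin (n + 1))) M] [IsManifold (𝓡 (n + 1)) ∞ M]
  {π : M → ℝ}

lemma verticalEndoCoord_apply (y : Rn n) (v : JetModel n) :
    verticalEndoCoord y v = ((0, 0), v.1.2 - v.1.1 • y) := rfl

/-- Gives both `J ∘ J = 0` and the vanishing of `J` on vertical vectors. -/
lemma verticalEndoCoord_of_fst_eq_zero (y : Rn n) {v : JetModel n} (hv : v.1 = 0) :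
    verticalEndoCoord y v = 0 := by
  rw [verticalEndoCoord_apply, hv]
  simp

lemma FibredChart.proj_jetChart_symm (e : FibredChart n π) (u₀ : J1 n π) {p : JetModel n}
    (hp : p ∈ (e.jetChart u₀).target) : ((e.jetChart u₀).symm p).proj = e.chart.symm p.1 :=
  congrArg J1.proj (e.jetInv_of_mem u₀ hp)

/-- The transition map between two jet charts is the prolongation of that between the fibred
charts. -/
lemma FibredChart.jetChart_transition_apply (e e' : FibredChart n π) (u₀ u₁ : J1 n π)
    {p : JetModel n} (hp : p.1 ∈ e.chart.target) (hp' : e.chart.symm p.1 ∈ e'.chart.source) :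
    e'.jetChart u₁ ((e.jetChart u₀).symm p) = ((e'.chart ∘ e.chart.symm) p.1,
      (fderiv ℝ (e'.chart ∘ e.chart.symm) p.1 ((1, p.2) : ℝ × Rn n)).2) := by
  have h1 : (e.jetChart u₀).symm p = e.jetOfCoord p hp := e.jetInv_of_mem u₀ hp
  have h2 : fderiv ℝ (e'.chart ∘ e.chart.symm) p.1 =
      (mfderiv (𝓡 (n + 1)) 𝓘(ℝ, ℝ × Rn n) e'.chart (e.chart.symm p.1)).comp
        (mfderiv 𝓘(ℝ, ℝ × Rn n) (𝓡 (n + 1)) e.chart.symm p.1) := by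
    rw [← mfderiv_eq_fderiv]
    exact mfderiv_comp p.1 (e'.mdiffAt hp') (e.mdiffAt_symm hp)
  rw [h1, h2]
  rfl

/-- The derivative of a transition map between two jet charts commutes with the vertical
endomorphism. -/
lemma FibredChart.fderiv_transition_verticalEndoCoord (e e' : FibredChart n π) (u₀ u₁ : J1 n π)
    {z : JetModel n} (hz : z.1 ∈ e.chart.target) (hz' : e.chart.symm z.1 ∈ e'.chart.source)
    (v : JetModel n) :
    fderiv ℝ (e'.jetChart u₁ ∘ (e.jetChart u₀).symm) z (verticalEndoCoord z.2 v) =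
      verticalEndoCoord (e'.jetChart u₁ ((e.jetChart u₀).symm z)).2
        (fderiv ℝ (e'.jetChart u₁ ∘ (e.jetChart u₀).symm) z v) := by
  set φ := e'.chart ∘ e.chart.symm with hφ
  set s : Set (ℝ × Rn n) := e.chart.target ∩ e.chart.symm ⁻¹' e'.chart.source with hs
  have hso : IsOpen s := e.chart.symm.isOpen_inter_preimage e'.chart.open_source
  have hzs : z.1 ∈ s := ⟨hz, hz'⟩
  have hsm : ContDiffOn ℝ ∞ φ s := by
    rw [← contMDiffOn_iff_contDiffOn]
    exact e'.smooth.comp (e.smooth_symm.mono inter_subset_left) (fun z hz => hz.2)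
  have hd : HasFDerivAt φ (fderiv ℝ φ z.1) z.1 :=
    ((hsm.contDiffAt (hso.mem_nhds hzs)).differentiableAt (by simp)).hasFDerivAt
  have hd2 : HasFDerivAt (fderiv ℝ φ) (fderiv ℝ (fderiv ℝ φ) z.1) z.1 :=
    (((hsm.fderiv_of_isOpen (m := ∞) hso (by simp)).contDiffAt
      (hso.mem_nhds hzs)).differentiableAt (by simp)).hasFDerivAt
  -- Both fibred charts have `π` as first coordinate, so the transition map preserves time.
  have hfst : ∀ a : ℝ × Rn n, (fderiv ℝ φ z.1 a).1 = a.1 := by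
    intro a
    have h1 : HasFDerivAt (fun p : ℝ × Rn n => (φ p).1) (ContinuousLinearMap.fst ℝ ℝ (Rn n)) z.1 := by
      refine hasFDerivAt_fst.congr_of_eventuallyEq ?_
      filter_upwards [hso.mem_nhds hzs] with p hp
      change (e'.chart (e.chart.symm p)).1 = p.1
      rw [e'.fst_eq _ hp.2, ← e.fst_eq _ (e.chart.map_target hp.1), e.chart.right_inv hp.1]
    exact DFunLike.congr_fun (hd.fst.unique h1) a
  have hpr : HasFDerivAt (fun p : JetModel n => p.1) (ContinuousLinearMap.fst ℝ (ℝ × Rn n) (Rn n)) z :=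
    hasFDerivAt_fst
  have hone : HasFDerivAt (fun p : JetModel n => ((1, p.2) : ℝ × Rn n))
      ((0 : JetModel n →L[ℝ] ℝ).prod (ContinuousLinearMap.snd ℝ (ℝ × Rn n) (Rn n))) z :=
    (hasFDerivAt_const (1 : ℝ) z).prodMk hasFDerivAt_snd
  -- The derivative of the prolongation `(φ, Dφ(1, y))` contains second derivatives of `φ`, but
  -- these are fed with the `(t, x)`-part of the argument. They vanish on `Jv`, and the outer `J` on
  -- the other side does not see them.
  have hT := (hd.comp z hpr).prodMk ((hd2.comp z hpr).clm_apply hone).snd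
  have hev : e'.jetChart u₁ ∘ (e.jetChart u₀).symm =ᶠ[𝓝 z] fun p =>
      (φ p.1, (fderiv ℝ φ p.1 ((1, p.2) : ℝ × Rn n)).2) := by
    filter_upwards [(hso.preimage continuous_fst).mem_nhds hzs] with p hp
    exact e.jetChart_transition_apply e' u₀ u₁ hp.1 hp.2
  rw [(hT.congr_of_eventuallyEq hev).fderiv, e.jetChart_transition_apply e' u₀ u₁ hz hz',
    verticalEndoCoord_apply, verticalEndoCoord_apply]
  -- The heart of the commutation: `(0, ξ - τ y) = (τ, ξ) - τ (1, y)`, and `Dφ(1, y)` carries the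
  -- new velocity in its second component.
  have hlin : fderiv ℝ φ z.1 ((0, v.1.2 - v.1.1 • z.2) : ℝ × Rn n) =
      fderiv ℝ φ z.1 v.1 - v.1.1 • fderiv ℝ φ z.1 ((1, z.2) : ℝ × Rn n) := by
    rw [← map_smul, ← map_sub]
    congr 1
    ext <;> simp
  have h0 : ((0, 0) : ℝ × Rn n) = 0 := rfl
  simp [hfst, hlin, h0, ← hφ]

variable [IsFibredOverReal n π]

lemma time_chart_symm {c : OpenPartialHomeomorph (J1 n π) (JetModel n)}
    (hc : c ∈ atlas (JetModel n) (J1 n π)) {z : JetModel n} (hz : z ∈ c.target) :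
    π (c.symm z).proj = z.1.1 := by
  obtain ⟨e, u₀, rfl⟩ := hc
  have hz' : z.1 ∈ e.chart.target := hz
  rw [e.proj_jetChart_symm u₀ hz, ← e.fst_eq _ (e.chart.map_target hz'), e.chart.right_inv hz']

variable (n π) in
lemma contMDiffOn_time :
    ContMDiffOn 𝓘(ℝ, JetModel n) 𝓘(ℝ, ℝ) ∞ (fun u : J1 n π => π u.proj) univ := by
  refine DForm.contMDiffOn_of_isSmoothOn_ofFun isOpen_univ fun c hc => ?_
  have h : ContDiff ℝ ∞ (fun z : JetModel n => z.1.1) := contDiff_fst.fst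
  refine (((ContinuousAlternatingMap.constOfIsEmptyLIE ℝ (JetModel n) ℝ
    (Fin 0)).contDiff.comp h).contDiffOn).congr fun z hz => ?_
  rw [DForm.ofFun_inChart]
  exact congrArg (ContinuousAlternatingMap.constOfIsEmpty ℝ (JetModel n) (Fin 0))
    (time_chart_symm hc hz.1)

lemma isSmoothOn_dtForm (W : Set (J1 n π)) : (dtForm n π).IsSmoothOn W :=
  (DForm.isSmoothOn_differential isOpen_univ (contMDiffOn_time n π)).mono (subset_univ W)

/-- In every jet chart `dt` is the differential of the first coordinate. -/
lemma dtForm_inChart_apply {c : OpenPartialHomeomorph (J1 n π) (JetModel n)}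
    (hc : c ∈ atlas (JetModel n) (J1 n π)) {z : JetModel n} (hz : z ∈ c.target)
    (w : Fin 1 → JetModel n) : (dtForm n π).inChart c z w = (w 0).1.1 := by
  unfold dtForm
  rw [DForm.differential_inChart_apply isOpen_univ (contMDiffOn_time n π) hc hz (mem_univ _)]
  have hev : (fun u : J1 n π => π u.proj) ∘ c.symm =ᶠ[𝓝 z] fun z => z.1.1 := by
    filter_upwards [c.open_target.mem_nhds hz] with p hp
    exact time_chart_symm hc hp
  have hd : HasFDerivAt (fun z : JetModel n => z.1.1)
    ((ContinuousLinearMap.fst ℝ ℝ (Rn n)).comp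
      (ContinuousLinearMap.fst ℝ (ℝ × Rn n) (Rn n))) z := hasFDerivAt_fst.fst
  rw [hev.fderiv_eq, hd.fderiv]
  rfl

lemma dtForm_eval {c : OpenPartialHomeomorph (J1 n π) (JetModel n)}
    (hc : c ∈ atlas (JetModel n) (J1 n π)) {u : J1 n π} (hu : u ∈ c.source)
    (v : TangentSpace 𝓘(ℝ, JetModel n) u) :
    (dtForm n π).eval u v =
      (mfderiv 𝓘(ℝ, JetModel n) 𝓘(ℝ, JetModel n) c u v : JetModel n).1.1 :=
  ((dtForm n π).apply_eq_inChart hc hu _).trans (dtForm_inChart_apply hc (c.map_source hu) _)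

/-- In every jet chart the vertical endomorphism is `∂/∂yⁱ ⊗ (dxⁱ - yⁱ dt)`. -/
lemma mfderiv_verticalEndo {c : OpenPartialHomeomorph (J1 n π) (JetModel n)}
    (hc : c ∈ atlas (JetModel n) (J1 n π)) {u : J1 n π} (hu : u ∈ c.source)
    (v : TangentSpace 𝓘(ℝ, JetModel n) u) :
    (mfderiv 𝓘(ℝ, JetModel n) 𝓘(ℝ, JetModel n) c u (verticalEndo n π u v) : JetModel n) =
      verticalEndoCoord (c u).2 (mfderiv 𝓘(ℝ, JetModel n) 𝓘(ℝ, JetModel n) c u v : JetModel n) := by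
  set c₀ := chartAt (JetModel n) u with hc₀_def
  have hc₀ : c₀ ∈ atlas (JetModel n) (J1 n π) := chart_mem_atlas _ u
  have hu₀ : u ∈ c₀.source := mem_chart_source _ u
  have hut : c₀ u ∈ c₀.target := c₀.map_source hu₀
  have hinv : c₀.symm (c₀ u) = u := c₀.left_inv hu₀
  have hcu : c₀.symm (c₀ u) ∈ c.source := by rwa [hinv]
  have hT := fun w : JetModel n => fderiv_transition hc₀ hc hut hcu w
  have hT' : ∀ w : JetModel n, fderiv ℝ (c ∘ c₀.symm) (c₀ u) w =
      (mfderiv 𝓘(ℝ, JetModel n) 𝓘(ℝ, JetModel n) c u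
        (mfderiv 𝓘(ℝ, JetModel n) 𝓘(ℝ, JetModel n) c₀.symm (c₀ u) w : JetModel n) :
          JetModel n) := by
    intro w
    have key : ∀ (a b : J1 n π) (_ : a = b) (w : JetModel n),
        (mfderiv 𝓘(ℝ, JetModel n) 𝓘(ℝ, JetModel n) c a w : JetModel n) =
          (mfderiv 𝓘(ℝ, JetModel n) 𝓘(ℝ, JetModel n) c b w : JetModel n) := by
      rintro a _ rfl w; rfl
    exact (hT w).trans (key _ _ hinv _)
  -- `verticalEndo` is defined through `c₀`; commutation with the transition to `c` makes its
  -- coordinate expression independent of the jet chart.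
  have hcomm : ∀ w : JetModel n, fderiv ℝ (c ∘ c₀.symm) (c₀ u) (verticalEndoCoord (c₀ u).2 w) =
      verticalEndoCoord (c u).2 (fderiv ℝ (c ∘ c₀.symm) (c₀ u) w) := by
    intro w
    have hc' := hc
    have hc₀' := hc₀
    obtain ⟨e', u₁, he'⟩ := hc'
    obtain ⟨e, u₀, he⟩ := hc₀'
    have h2 : e.chart.symm (c₀ u).1 ∈ e'.chart.source := by
      have h3 : (c₀.symm (c₀ u)).proj = e.chart.symm (c₀ u).1 := by
        have := e.proj_jetChart_symm u₀ (p := c₀ u) (by rw [← he]; exact hut)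
        rwa [← he] at this
      rw [← h3, hinv]
      rw [he'] at hu
      exact hu
    have h1 : (c₀ u).1 ∈ e.chart.target := by
      have := hut
      rw [he] at this ⊢
      exact this
    have := e.fderiv_transition_verticalEndoCoord e' u₀ u₁ h1 h2 w
    rw [← he, ← he'] at this
    rwa [hinv] at this
  have hv : (mfderiv 𝓘(ℝ, JetModel n) 𝓘(ℝ, JetModel n) c₀.symm (c₀ u)
      (mfderiv 𝓘(ℝ, JetModel n) 𝓘(ℝ, JetModel n) c₀ u v) : JetModel n) = v :=
    mfderiv_symm_mfderiv_of_mem_atlas hc₀ hu₀ v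
  have h := hcomm (mfderiv 𝓘(ℝ, JetModel n) 𝓘(ℝ, JetModel n) c₀ u v : JetModel n)
  refine (hT' _).symm.trans (h.trans ?_)
  refine congrArg (verticalEndoCoord (c u).2) ((hT' _).trans ?_)
  exact congrArg (mfderiv 𝓘(ℝ, JetModel n) 𝓘(ℝ, JetModel n) c u) hv

/-- A tangent vector is vertical if and only if its `(t, x)`-components vanish. -/
lemma mfderiv_proj_eq_zero_iff {c : OpenPartialHomeomorph (J1 n π) (JetModel n)}
    (hc : c ∈ atlas (JetModel n) (J1 n π)) {u : J1 n π} (hu : u ∈ c.source)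
    (v : TangentSpace 𝓘(ℝ, JetModel n) u) :
    mfderiv 𝓘(ℝ, JetModel n) (𝓡 (n + 1)) (J1.proj : J1 n π → M) u v = 0 ↔
      (mfderiv 𝓘(ℝ, JetModel n) 𝓘(ℝ, JetModel n) c u v : JetModel n).1 = 0 := by
  have hdc := ((mdifferentiable_of_mem_atlas_infty hc).mdifferentiableAt hu).hasMFDerivAt
  obtain ⟨e, u₀, rfl⟩ := hc
  have hue : u.proj ∈ e.chart.source := hu
  have hut : (e.jetChart u₀ u).1 ∈ e.chart.target := e.chart.map_source hue
  have hfst : HasMFDerivAt 𝓘(ℝ, JetModel n) 𝓘(ℝ, ℝ × Rn n) (fun p : JetModel n => p.1)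
      (e.jetChart u₀ u) (ContinuousLinearMap.fst ℝ (ℝ × Rn n) (Rn n)) :=
    hasFDerivAt_fst.hasMFDerivAt
  have hsy := (e.mdiffAt_symm hut).hasMFDerivAt
  have hcomp := HasMFDerivAt.comp u hsy (HasMFDerivAt.comp u hfst hdc)
  -- In coordinates `π₁₀` is the projection to `(t, x)` followed by the local diffeomorphism
  -- `e.chart.symm`, so its kernel is read off from the `(t, x)`-components.
  have hev : (J1.proj : J1 n π → M) =ᶠ[𝓝 u]
      e.chart.symm ∘ (fun p : JetModel n => p.1) ∘ e.jetChart u₀ := by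
    filter_upwards [(e.jetChart u₀).open_source.mem_nhds hu] with a ha
    exact (e.chart.left_inv ha).symm
  have hm := (hcomp.congr_of_eventuallyEq hev).mfderiv
  have hm' : (mfderiv 𝓘(ℝ, JetModel n) (𝓡 (n + 1)) (J1.proj : J1 n π → M) u v :
      EuclideanSpace ℝ (Fin (n + 1))) = mfderiv 𝓘(ℝ, ℝ × Rn n) (𝓡 (n + 1)) e.chart.symm
        (e.jetChart u₀ u).1
        (mfderiv 𝓘(ℝ, JetModel n) 𝓘(ℝ, JetModel n) (e.jetChart u₀) u v : JetModel n).1 :=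
    DFunLike.congr_fun hm v
  refine ⟨fun h => ?_, fun h => ?_⟩
  · have h1 := e.mfderiv_mfderiv_symm hut
      (mfderiv 𝓘(ℝ, JetModel n) 𝓘(ℝ, JetModel n) (e.jetChart u₀) u v : JetModel n).1
    refine h1.symm.trans ?_
    have h2 := hm'.symm.trans h
    refine (congrArg _ h2).trans ?_
    exact map_zero (mfderiv (𝓡 (n + 1)) 𝓘(ℝ, ℝ × Rn n) e.chart
      (e.chart.symm (e.jetChart u₀ u).1))
  · refine hm'.trans ((congrArg _ h).trans ?_)
    exact map_zero (mfderiv 𝓘(ℝ, ℝ × Rn n) (𝓡 (n + 1)) e.chart.symm (e.jetChart u₀ u).1)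

lemma mfderiv_chart_injective {c : OpenPartialHomeomorph (J1 n π) (JetModel n)}
    (hc : c ∈ atlas (JetModel n) (J1 n π)) {u : J1 n π} (hu : u ∈ c.source)
    {v : TangentSpace 𝓘(ℝ, JetModel n) u}
    (hv : (mfderiv 𝓘(ℝ, JetModel n) 𝓘(ℝ, JetModel n) c u v : JetModel n) = 0) : v = 0 := by
  refine (mfderiv_symm_mfderiv_of_mem_atlas hc hu v).symm.trans ((congrArg _ hv).trans ?_)
  exact map_zero (mfderiv 𝓘(ℝ, JetModel n) 𝓘(ℝ, JetModel n) c.symm (c u))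

lemma mfderiv_proj_verticalEndo (u : J1 n π) (v : TangentSpace 𝓘(ℝ, JetModel n) u) :
    mfderiv 𝓘(ℝ, JetModel n) (𝓡 (n + 1)) (J1.proj : J1 n π → M) u (verticalEndo n π u v) = 0 := by
  have hc := chart_mem_atlas (JetModel n) u
  have hu := mem_chart_source (JetModel n) u
  rw [mfderiv_proj_eq_zero_iff hc hu, mfderiv_verticalEndo hc hu]
  rfl

lemma verticalEndo_eq_zero {u : J1 n π} {v : TangentSpace 𝓘(ℝ, JetModel n) u}
    (hv : mfderiv 𝓘(ℝ, JetModel n) (𝓡 (n + 1)) (J1.proj : J1 n π → M) u v = 0) :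
    verticalEndo n π u v = 0 := by
  have hc := chart_mem_atlas (JetModel n) u
  have hu := mem_chart_source (JetModel n) u
  rw [mfderiv_proj_eq_zero_iff hc hu] at hv
  refine mfderiv_chart_injective hc hu ?_
  rw [mfderiv_verticalEndo hc hu]
  exact verticalEndoCoord_of_fst_eq_zero _ hv

lemma dtForm_eval_eq_zero {u : J1 n π} {v : TangentSpace 𝓘(ℝ, JetModel n) u}
    (hv : mfderiv 𝓘(ℝ, JetModel n) (𝓡 (n + 1)) (J1.proj : J1 n π → M) u v = 0) :
    (dtForm n π).eval u v = 0 := by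
  have hc := chart_mem_atlas (JetModel n) u
  have hu := mem_chart_source (JetModel n) u
  rw [mfderiv_proj_eq_zero_iff hc hu] at hv
  rw [dtForm_eval hc hu, hv]
  rfl

/-- In jet coordinates a semispray is `∂/∂t + yⁱ ∂/∂xⁱ + Gⁱ ∂/∂yⁱ`. -/
lemma IsSemispray.inChart_fst {S : VField (JetModel n) (J1 n π)} (hS : IsSemispray S)
    {c : OpenPartialHomeomorph (J1 n π) (JetModel n)}
    (hc : c ∈ atlas (JetModel n) (J1 n π)) {z : JetModel n} (hz : z ∈ c.target) :
    (S.inChart c z).1 = (1, z.2) := by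
  have hu := c.map_target hz
  have h1 : (S.inChart c z).1.1 = 1 := (dtForm_eval hc hu _).symm.trans (hS.time (c.symm z))
  -- For `S` with components `(τ, ξ)` the equation `JS = 0` reads `ξ - τ y = 0`, and `τ = 1`.
  have h2 := mfderiv_verticalEndo hc hu (S (c.symm z))
  rw [hS.vertical, c.right_inv hz] at h2
  have h3 : verticalEndoCoord z.2 (S.inChart c z) = 0 :=
    h2.symm.trans (map_zero (mfderiv 𝓘(ℝ, JetModel n) 𝓘(ℝ, JetModel n) c (c.symm z)))
  rw [verticalEndoCoord_apply, h1, one_smul] at h3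
  exact Prod.ext h1 (sub_eq_zero.1 (congrArg Prod.snd h3))

end JetCharts

/-! ### Two identities for `1`-forms in jet coordinates -/

section CoordinateIdentities

variable {n : ℕ}

/-- A `1`-form on a vector space as a field of linear functionals. -/
noncomputable def covectorField {E : Type*} [NormedAddCommGroup E] [NormedSpace ℝ E]
    (a : E → E [⋀^Fin 1]→L[ℝ] ℝ) (z : E) : E →L[ℝ] ℝ :=
  (ContinuousAlternatingMap.ofSubsingletonLIE (𝕜 := ℝ) (E := E) (F := ℝ) (0 : Fin 1)).symm (a z)

lemma hasFDerivAt_covectorField {E : Type*} [NormedAddCommGroup E] [NormedSpace ℝ E]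
    {a : E → E [⋀^Fin 1]→L[ℝ] ℝ} {z : E} (ha : DifferentiableAt ℝ a z) :
    ∃ D : E →L[ℝ] E →L[ℝ] ℝ, HasFDerivAt (covectorField a) D z ∧
      ∀ v w, D v w = fderiv ℝ a z v (fun _ => w) :=
  ⟨_, ((ContinuousAlternatingMap.ofSubsingletonLIE (𝕜 := ℝ) (E := E) (F := ℝ)
    (0 : Fin 1)).symm.toContinuousLinearEquiv.toContinuousLinearMap.hasFDerivAt
      (x := a z)).comp z ha.hasFDerivAt, fun _ _ => rfl⟩

/-- For a semi-basic `1`-form `a` and a semispray `s` in jet coordinates,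
`d(a(s))(X) + da(s, X) = a(X^h)` for vertical `X`, where `X^h` is `X` moved to the
`x`-directions. -/
lemma fderiv_contract_add_extDeriv {a : JetModel n → JetModel n [⋀^Fin 1]→L[ℝ] ℝ}
    {s : JetModel n → JetModel n} {z : JetModel n} (ha : DifferentiableAt ℝ a z)
    (hs : DifferentiableAt ℝ s z)
    (hsb : ∀ᶠ w in 𝓝 z, ∀ v : JetModel n, v.1 = 0 → a w (fun _ => v) = 0)
    (hs1 : ∀ᶠ w in 𝓝 z, (s w).1 = (1, w.2)) {X : JetModel n} (hX : X.1 = 0) :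
    fderiv ℝ (fun w => a w (fun _ => s w)) z X + extDeriv a z ![s z, X] =
      a z (fun _ => ((0, X.2), 0)) := by
  obtain ⟨D, hD, hDa⟩ := hasFDerivAt_covectorField ha
  have h1 : HasFDerivAt (fun w => a w (fun _ => s w))
      ((covectorField a z).comp (fderiv ℝ s z) + D.flip (s z)) z :=
    hD.clm_apply hs.hasFDerivAt
  -- The `(t, x)`-part of `s` is `(1, y)`, so its derivative along a vertical `X` is `X` moved to
  -- the `x`-directions.
  have h2 : (fderiv ℝ s z X).1 = (0, X.2) := by
    have h3 : HasFDerivAt (fun w : JetModel n => ((1, w.2) : ℝ × Rn n))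
        ((0 : JetModel n →L[ℝ] ℝ).prod (ContinuousLinearMap.snd ℝ (ℝ × Rn n) (Rn n))) z :=
      (hasFDerivAt_const (1 : ℝ) z).prodMk hasFDerivAt_snd
    exact DFunLike.congr_fun (hs.hasFDerivAt.fst.unique (h3.congr_of_eventuallyEq hs1)) X
  -- The function `a(X)` vanishes near `z` for the constant vertical vector `X`, so its derivative
  -- along `s` does too. The remaining terms `D X s` in `d(a(s))(X)` and in `da(s, X)` cancel.
  have h4 : D (s z) X = 0 := by
    have h5 : HasFDerivAt (fun w => covectorField a w X) (0 : JetModel n →L[ℝ] ℝ) z := by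
      refine (hasFDerivAt_const (0 : ℝ) z).congr_of_eventuallyEq ?_
      filter_upwards [hsb] with w hw
      exact hw X hX
    have h6 := (hD.clm_apply (hasFDerivAt_const X z)).unique h5
    simpa using DFunLike.congr_fun h6 (s z)
  have h7 : covectorField a z (fderiv ℝ s z X) = covectorField a z ((0, X.2), 0) := by
    rw [← sub_eq_zero, ← map_sub]
    refine hsb.self_of_nhds _ ?_
    rw [Prod.fst_sub, h2, sub_self]
  rw [h1.fderiv, extDeriv_one_apply, ← hDa, ← hDa, h4]
  have h8 : covectorField a z ((0, X.2), 0) = a z (fun _ => ((0, X.2), 0)) := rfl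
  rw [← h8, ← h7]
  simp

lemma contDiff_verticalEndoCoord : ContDiff ℝ ∞ (verticalEndoCoord (n := n)) := by
  unfold verticalEndoCoord
  refine contDiff_const.clm_comp (ContDiff.clm_comp ?_ contDiff_const)
  exact contDiff_const.sub (contDiff_const.smulRight contDiff_id)

/-- For `a = ℓ dt + d_J ℓ` in jet coordinates, `da(JX, Y)` is symmetric in `X` and `Y`. -/
lemma extDeriv_poincareCartan_verticalEndoCoord {a : JetModel n → JetModel n [⋀^Fin 1]→L[ℝ] ℝ}
    {l : JetModel n → ℝ} {z : JetModel n} (ha : DifferentiableAt ℝ a z) (hl : ContDiffAt ℝ ∞ l z)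
    (hal : ∀ᶠ w in 𝓝 z, ∀ v : JetModel n,
      a w (fun _ => v) = l w * v.1.1 + fderiv ℝ l w (verticalEndoCoord w.2 v))
    (X Y : JetModel n) :
    extDeriv a z ![verticalEndoCoord z.2 X, Y] = extDeriv a z ![verticalEndoCoord z.2 Y, X] := by
  obtain ⟨D, hD, hDa⟩ := hasFDerivAt_covectorField ha
  have hl1 : HasFDerivAt l (fderiv ℝ l z) z := (hl.differentiableAt (by simp)).hasFDerivAt
  have hl2 : HasFDerivAt (fderiv ℝ l) (fderiv ℝ (fderiv ℝ l) z) z :=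
    ((hl.fderiv_right (m := ∞) (by simp)).differentiableAt (by simp)).hasFDerivAt
  have hsymm : ∀ v w, fderiv ℝ (fderiv ℝ l) z v w = fderiv ℝ (fderiv ℝ l) z w v :=
    (hl.isSymmSndFDerivAt minSmoothness_two_le_infty).eq
  have hJ : ∀ w : JetModel n, HasFDerivAt (fun p : JetModel n => verticalEndoCoord p.2 w)
      ((ContinuousLinearMap.inr ℝ (ℝ × Rn n) (Rn n)).comp
        (-(w.1.1 • ContinuousLinearMap.snd ℝ (ℝ × Rn n) (Rn n)))) z := by
    intro w
    have h1 : HasFDerivAt (fun p : JetModel n => w.1.2 - w.1.1 • p.2)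
        (-(w.1.1 • ContinuousLinearMap.snd ℝ (ℝ × Rn n) (Rn n))) z :=
      ((hasFDerivAt_snd (𝕜 := ℝ) (p := z)).const_smul w.1.1).const_sub _
    exact (ContinuousLinearMap.inr ℝ (ℝ × Rn n) (Rn n)).hasFDerivAt.comp z h1
  -- Product rule for `ℓ dt + dℓ ∘ J`; the last term comes from the dependence of `J` on `y`.
  have key : ∀ v w, D v w = fderiv ℝ l z v * w.1.1 +
      (fderiv ℝ (fderiv ℝ l) z v (verticalEndoCoord z.2 w)
        - w.1.1 * fderiv ℝ l z (0, v.2)) := by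
    intro v w
    have h1 := (hl1.mul_const w.1.1).add (hl2.clm_apply (hJ w))
    have h2 : HasFDerivAt (fun p => covectorField a p w) (D.flip w) z := by
      simpa using hD.clm_apply (hasFDerivAt_const w z)
    have h3 := h2.unique (h1.congr_of_eventuallyEq (by
      filter_upwards [hal] with p hp
      exact hp w))
    have h4 := DFunLike.congr_fun h3 v
    simp only [ContinuousLinearMap.flip_apply, add_apply,
      smul_apply, ContinuousLinearMap.comp_apply,
      neg_apply, ContinuousLinearMap.coe_snd',
      ContinuousLinearMap.inr_apply, smul_eq_mul, map_neg, map_smul] at h4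
    rw [h4]
    ring
  have hJJ : ∀ v : JetModel n, verticalEndoCoord z.2 (verticalEndoCoord z.2 v) = 0 := fun v =>
    verticalEndoCoord_of_fst_eq_zero _ rfl
  have hJt : ∀ v : JetModel n, (verticalEndoCoord z.2 v).1.1 = 0 := fun _ => rfl
  have hJs : ∀ v : JetModel n, ((0, (verticalEndoCoord z.2 v).2) : JetModel n)
    = verticalEndoCoord z.2 v := fun _ => rfl
  -- With `J ∘ J = 0` and `dt ∘ J = 0` every first-order term cancels, and `da(JX, Y)` is the second
  -- derivative of `ℓ` along `JX` and `JY`.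
  have hone : ∀ v w : JetModel n, extDeriv a z ![verticalEndoCoord z.2 v, w] =
      fderiv ℝ (fderiv ℝ l) z (verticalEndoCoord z.2 v) (verticalEndoCoord z.2 w) := by
    intro v w
    rw [extDeriv_one_apply, ← hDa, ← hDa, key, key, hJJ, hJt, hJs, map_zero]
    ring
  rw [hone, hone, hsymm]

/-- A constant covector is enough for `f dt`, since `dt` has constant coefficients in every jet
chart. -/
lemma extDeriv_smul_const_apply {E : Type*} [NormedAddCommGroup E] [NormedSpace ℝ E]
    {f : E → ℝ} {z : E} (hf : DifferentiableAt ℝ f z) (b : E [⋀^Fin 1]→L[ℝ] ℝ) (v w : E) :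
    extDeriv (fun p => f p • b) z ![v, w] =
      fderiv ℝ f z v * b (fun _ => w) - fderiv ℝ f z w * b (fun _ => v) := by
  have h : HasFDerivAt (fun p => f p • b) ((fderiv ℝ f z).smulRight b) z := by
    exact HasFDerivAt.smul_const (F := E [⋀^Fin 1]→L[ℝ] ℝ) hf.hasFDerivAt b
  rw [extDeriv_one_apply, h.fderiv]
  rfl

end CoordinateIdentities

/-! ### Semi-basic forms and Poincaré-Cartan forms on the jet bundle -/

section JetForms

variable {n : ℕ} {M : Type*} [TopologicalSpace M]
  [ChartedSpace (EuclideanSpace ℝ (Fin (n + 1))) M] [IsManifold (𝓡 (n + 1)) ∞ M]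
  {π : M → ℝ} [IsFibredOverReal n π]

lemma smulDt_eval (f : J1 n π → ℝ) (u : J1 n π) (v : TangentSpace 𝓘(ℝ, JetModel n) u) :
    (smulDt f).eval u v = f u * (dtForm n π).eval u v := rfl

/-- The working formula for `θ_L`, with `d_J L = dL ∘ J`. -/
lemma poincareCartan_eval (L : J1 n π → ℝ) (u : J1 n π) (v : TangentSpace 𝓘(ℝ, JetModel n) u) :
    (poincareCartan L).eval u v = L u * (dtForm n π).eval u v +
      (DForm.differential L).eval u (verticalEndo n π u v) := by
  unfold poincareCartan dJ
  rw [DForm.dEndo_ofFun, DForm.eval_add, smulDt_eval, DForm.insertion_one_eval]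

lemma isSemibasicOn_poincareCartan (L : J1 n π → ℝ) (W : Set (J1 n π)) :
    IsSemibasicOn (poincareCartan L) W := by
  intro u _ v hv
  rw [poincareCartan_eval, dtForm_eval_eq_zero hv, verticalEndo_eq_zero hv, DForm.eval_map_zero]
  simp

lemma isSemibasicOn_smulDt (f : J1 n π → ℝ) (W : Set (J1 n π)) :
    IsSemibasicOn (smulDt f) W := by
  intro u _ v hv
  rw [smulDt_eval, dtForm_eval_eq_zero hv, mul_zero]

lemma IsSemibasicOn.add {θ θ' : DForm (JetModel n) (J1 n π) 1} {W : Set (J1 n π)}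
    (h : IsSemibasicOn θ W) (h' : IsSemibasicOn θ' W) : IsSemibasicOn (θ + θ') W := by
  intro u hu v hv
  rw [DForm.eval_add, h u hu v hv, h' u hu v hv, add_zero]

lemma IsSemibasicOn.eval_verticalEndo {θ : DForm (JetModel n) (J1 n π) 1} {W : Set (J1 n π)}
    (h : IsSemibasicOn θ W) {u : J1 n π} (hu : u ∈ W) (v : TangentSpace 𝓘(ℝ, JetModel n) u) :
    θ.eval u (verticalEndo n π u v) = 0 :=
  h u hu _ (mfderiv_proj_verticalEndo u v)

lemma smulDt_inChart (f : J1 n π → ℝ) (c : OpenPartialHomeomorph (J1 n π) (JetModel n))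
    (z : JetModel n) : (smulDt f).inChart c z = f (c.symm z) • (dtForm n π).inChart c z := rfl

lemma isSmoothOn_smulDt {f : J1 n π → ℝ} {W : Set (J1 n π)}
    (hf : ContMDiffOn 𝓘(ℝ, JetModel n) 𝓘(ℝ, ℝ) ∞ f W) : (smulDt f).IsSmoothOn W := by
  intro c hc
  have h1 := contMDiffOn_symm_of_mem_maximalAtlas (I := 𝓘(ℝ, JetModel n)) (n := ∞)
    (IsManifold.subset_maximalAtlas hc)
  have h2 : ContDiffOn ℝ ∞ (f ∘ c.symm) (c.target ∩ c.symm ⁻¹' W) := by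
    rw [← contMDiffOn_iff_contDiffOn]
    exact hf.comp (h1.mono inter_subset_left) fun z hz => hz.2
  exact h2.smul (isSmoothOn_dtForm W c hc)

/-- In a chart `i_J θ` is the covector field of `θ` composed with the matrix of `J`, which is affine
in `y`. -/
lemma isSmoothOn_insertion_verticalEndo {θ : DForm (JetModel n) (J1 n π) 1} {W : Set (J1 n π)}
    (hθ : θ.IsSmoothOn W) : (DForm.insertion (verticalEndo n π) θ).IsSmoothOn W := by
  intro c hc
  have h1 : ContDiffOn ℝ ∞ (covectorField (θ.inChart c)) (c.target ∩ c.symm ⁻¹' W) :=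
    (ContinuousAlternatingMap.ofSubsingletonLIE (𝕜 := ℝ) (E := JetModel n) (F := ℝ)
      (0 : Fin 1)).symm.contDiff.comp_contDiffOn (hθ c hc)
  have h2 : ContDiffOn ℝ ∞ (fun z : JetModel n => verticalEndoCoord z.2)
      (c.target ∩ c.symm ⁻¹' W) := (contDiff_verticalEndoCoord.comp contDiff_snd).contDiffOn
  refine ((ContinuousAlternatingMap.ofSubsingletonLIE (𝕜 := ℝ) (E := JetModel n) (F := ℝ)
    (0 : Fin 1)).contDiff.comp_contDiffOn (h1.clm_comp h2)).congr fun z hz => ?_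
  ext w
  have hu := c.map_target hz.1
  have hcz := c.right_inv hz.1
  have h3 := mfderiv_verticalEndo hc hu (mfderiv 𝓘(ℝ, JetModel n) 𝓘(ℝ, JetModel n) c.symm z (w 0))
  have h4 : (mfderiv 𝓘(ℝ, JetModel n) 𝓘(ℝ, JetModel n) c (c.symm z)
      (mfderiv 𝓘(ℝ, JetModel n) 𝓘(ℝ, JetModel n) c.symm z (w 0)) : JetModel n) = w 0 :=
    mfderiv_mfderiv_symm_of_mem_atlas hc hz.1 (w 0)
  have hw : w = fun _ => w 0 := funext fun i => by fin_cases i; rfl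
  have h5 : (DForm.insertion (verticalEndo n π) θ).inChart c z w =
      (DForm.insertion (verticalEndo n π) θ).eval (c.symm z)
        (mfderiv 𝓘(ℝ, JetModel n) 𝓘(ℝ, JetModel n) c.symm z (w 0)) := by
    conv_lhs => rw [hw]
    rfl
  rw [h5, DForm.insertion_one_eval]
  refine (θ.apply_eq_inChart hc hu _).trans ?_
  rw [hcz]
  refine congrArg (θ.inChart c z) (funext fun _ => h3.trans ?_)
  rw [hcz]
  exact congrArg (verticalEndoCoord z.2) h4

lemma isSmoothOn_poincareCartan {L : J1 n π → ℝ} {W : Set (J1 n π)} (hW : IsOpen W)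
    (hL : ContMDiffOn 𝓘(ℝ, JetModel n) 𝓘(ℝ, ℝ) ∞ L W) : (poincareCartan L).IsSmoothOn W := by
  refine (isSmoothOn_smulDt hL).add ?_
  unfold dJ
  rw [DForm.dEndo_ofFun]
  exact isSmoothOn_insertion_verticalEndo (DForm.isSmoothOn_differential hW hL)

lemma differential_eval {f : J1 n π → ℝ} {W : Set (J1 n π)} (hW : IsOpen W)
    (hf : ContMDiffOn 𝓘(ℝ, JetModel n) 𝓘(ℝ, ℝ) ∞ f W)
    {c : OpenPartialHomeomorph (J1 n π) (JetModel n)} (hc : c ∈ atlas (JetModel n) (J1 n π))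
    {u : J1 n π} (hu : u ∈ c.source) (huW : u ∈ W) (v : TangentSpace 𝓘(ℝ, JetModel n) u) :
    (DForm.differential f : DForm (JetModel n) (J1 n π) 1).eval u v =
      fderiv ℝ (f ∘ c.symm) (c u)
        (mfderiv 𝓘(ℝ, JetModel n) 𝓘(ℝ, JetModel n) c u v : JetModel n) :=
  ((DForm.differential f : DForm (JetModel n) (J1 n π) 1).apply_eq_inChart hc hu _).trans
    (DForm.differential_inChart_apply hW hf hc (c.map_source hu) (by rwa [c.left_inv hu]) _)

lemma extD_apply {θ : DForm (JetModel n) (J1 n π) 1} {W : Set (J1 n π)} (hW : IsOpen W)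
    (hθ : θ.IsSmoothOn W) {c : OpenPartialHomeomorph (J1 n π) (JetModel n)}
    (hc : c ∈ atlas (JetModel n) (J1 n π)) {u : J1 n π} (hu : u ∈ c.source) (huW : u ∈ W)
    (v w : TangentSpace 𝓘(ℝ, JetModel n) u) :
    θ.extD u ![v, w] = extDeriv (θ.inChart c) (c u)
      ![(mfderiv 𝓘(ℝ, JetModel n) 𝓘(ℝ, JetModel n) c u v : JetModel n),
        (mfderiv 𝓘(ℝ, JetModel n) 𝓘(ℝ, JetModel n) c u w : JetModel n)] := by
  refine (θ.extD.apply_eq_inChart hc hu _).trans ?_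
  rw [DForm.extD_inChart hW hθ hc (c.map_source hu) (by rwa [c.left_inv hu])]
  exact congrArg (extDeriv (θ.inChart c) (c u)) (funext fun i => by fin_cases i <;> rfl)

/-- `d(f dt) = df ∧ dt`. -/
lemma extD_smulDt {f : J1 n π → ℝ} {W : Set (J1 n π)} (hW : IsOpen W)
    (hf : ContMDiffOn 𝓘(ℝ, JetModel n) 𝓘(ℝ, ℝ) ∞ f W) {u : J1 n π} (hu : u ∈ W) :
    (smulDt f).extD u = (DForm.differential f).wedge (dtForm n π) u := by
  have hc := chart_mem_atlas (JetModel n) u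
  have hus := mem_chart_source (JetModel n) u
  set c := chartAt (JetModel n) u
  have huW : c.symm (c u) ∈ W := by rwa [c.left_inv hus]
  refine DForm.ext_two fun v w => ?_
  rw [DForm.wedge_apply, extD_apply hW (isSmoothOn_smulDt hf) hc hus hu,
    differential_eval hW hf hc hus hu, differential_eval hW hf hc hus hu]
  -- Near `c u` the covector of `dt` can be frozen at its value at `c u`.
  have hev : (smulDt f).inChart c =ᶠ[𝓝 (c u)]
      fun z => (f ∘ c.symm) z • (dtForm n π).inChart c (c u) := by
    filter_upwards [c.open_target.mem_nhds (c.map_source hus)] with z hz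
    rw [smulDt_inChart]
    refine congrArg (f (c.symm z) • ·) ?_
    ext w
    rw [dtForm_inChart_apply hc hz, dtForm_inChart_apply hc (c.map_source hus)]
  have hd : DifferentiableAt ℝ (f ∘ c.symm) (c u) := by
    have h := (DForm.isSmoothOn_ofFun hf).contDiffAt hW hc (c.map_source hus) huW
    exact ((ContinuousAlternatingMap.constOfIsEmptyLIE ℝ (JetModel n) ℝ
      (Fin 0)).symm.contDiff.contDiffAt.comp _ h).differentiableAt (by simp)
  rw [hev.extDeriv_eq]
  refine (extDeriv_smul_const_apply hd _ _ _).trans ?_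
  have hdt := fun x : TangentSpace 𝓘(ℝ, JetModel n) u =>
    ((dtForm n π).apply_eq_inChart hc hus fun _ => x).symm
  exact congrArg₂ (fun a b : ℝ =>
    fderiv ℝ (f ∘ c.symm) (c u) (mfderiv 𝓘(ℝ, JetModel n) 𝓘(ℝ, JetModel n) c u v) * a -
      fderiv ℝ (f ∘ c.symm) (c u) (mfderiv 𝓘(ℝ, JetModel n) 𝓘(ℝ, JetModel n) c u w) * b)
    (hdt w) (hdt v)

/-- A semi-basic `1`-form `θ` with `A = θ(S)` satisfies `θ = A dt + d_J A + i_J i_S dθ`. -/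
lemma semibasic_eval_eq {S : VField (JetModel n) (J1 n π)} (hS : IsSemispray S)
    {θ : DForm (JetModel n) (J1 n π) 1} {W : Set (J1 n π)} (hW : IsOpen W)
    (hθ : θ.IsSmoothOn W) (hsb : IsSemibasicOn θ W) {u : J1 n π} (hu : u ∈ W)
    (v : TangentSpace 𝓘(ℝ, JetModel n) u) :
    θ.eval u v = (poincareCartan fun u => θ.eval u (S u)).eval u v +
      (DForm.interior S θ.extD).eval u (verticalEndo n π u v) := by
  have hc := chart_mem_atlas (JetModel n) u
  have hus := mem_chart_source (JetModel n) u
  set c := chartAt (JetModel n) u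
  have hut := c.map_source hus
  have huW : c.symm (c u) ∈ W := by rwa [c.left_inv hus]
  have hA : ContMDiffOn 𝓘(ℝ, JetModel n) 𝓘(ℝ, ℝ) ∞ (fun u => θ.eval u (S u)) W := by
    refine DForm.contMDiffOn_of_isSmoothOn_ofFun hW ?_
    rw [← DForm.interior_eq_ofFun]
    exact hθ.interior hS.smooth
  set V : JetModel n := mfderiv 𝓘(ℝ, JetModel n) 𝓘(ℝ, JetModel n) c u v with hV
  have hJ : (mfderiv 𝓘(ℝ, JetModel n) 𝓘(ℝ, JetModel n) c u (verticalEndo n π u v) : JetModel n)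
    = verticalEndoCoord (c u).2 V := mfderiv_verticalEndo hc hus v
  have hSu : (mfderiv 𝓘(ℝ, JetModel n) 𝓘(ℝ, JetModel n) c u (S u) : JetModel n)
      = S.inChart c (c u) := by
    have key : ∀ (a b : J1 n π) (_ : a = b),
        (mfderiv 𝓘(ℝ, JetModel n) 𝓘(ℝ, JetModel n) c a (S a) : JetModel n) =
          (mfderiv 𝓘(ℝ, JetModel n) 𝓘(ℝ, JetModel n) c b (S b) : JetModel n) := by
      rintro a _ rfl; rfl
    exact key _ _ (c.left_inv hus).symm
  have hnhds : c.target ∩ c.symm ⁻¹' W ∈ 𝓝 (c u) :=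
    (c.symm.isOpen_inter_preimage hW).mem_nhds ⟨hut, huW⟩
  have hsb' : ∀ᶠ w in 𝓝 (c u), ∀ x : JetModel n, x.1 = 0 → θ.inChart c w (fun _ => x) = 0 := by
    filter_upwards [hnhds] with w hw x hx
    refine hsb (c.symm w) hw.2 (mfderiv 𝓘(ℝ, JetModel n) 𝓘(ℝ, JetModel n) c.symm w x) ?_
    rw [mfderiv_proj_eq_zero_iff hc (c.map_target hw.1)]
    exact (congrArg Prod.fst (mfderiv_mfderiv_symm_of_mem_atlas hc hw.1 x)).trans hx
  have hs1 : ∀ᶠ w in 𝓝 (c u), (S.inChart c w).1 = (1, w.2) := by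
    filter_upwards [hnhds] with w hw
    exact hS.inChart_fst hc hw.1
  have hAc : (fun u => θ.eval u (S u)) ∘ c.symm =ᶠ[𝓝 (c u)]
      fun w => θ.inChart c w (fun _ => S.inChart c w) := by
    filter_upwards [hnhds] with w hw
    exact congrArg (θ (c.symm w)) (funext fun _ => (DForm.mfderiv_symm_inChart S hc hw.1).symm)
  -- Taking the vertical vector to be `JV` turns the right-hand side into `θ` evaluated on the
  -- `x`-vector with components `ξ - τ y`.
  have hmain := fderiv_contract_add_extDeriv
    ((hθ.contDiffAt hW hc hut huW).differentiableAt (by simp))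
    (((DForm.contDiffOn_inChart_of_contMDiff hS.smooth hc).contDiffAt
      (c.open_target.mem_nhds hut)).differentiableAt (by simp)) hsb' hs1
    (X := verticalEndoCoord (c u).2 V) rfl
  have hθS : θ.eval u (S u) = θ.inChart c (c u) (fun _ => S.inChart c (c u)) := by
    refine (θ.apply_eq_inChart hc hus _).trans ?_
    exact congrArg (θ.inChart c (c u)) (funext fun _ => hSu)
  have hθv : θ.eval u v = θ.inChart c (c u) (fun _ => V) := θ.apply_eq_inChart hc hus _
  have hint : (DForm.interior S θ.extD).eval u (verticalEndo n π u v) =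
      extDeriv (θ.inChart c) (c u) ![S.inChart c (c u), verticalEndoCoord (c u).2 V] := by
    have h1 : (DForm.interior S θ.extD).eval u (verticalEndo n π u v) =
        θ.extD u ![S u, verticalEndo n π u v] :=
      congrArg (θ.extD u) (funext fun i => by fin_cases i <;> rfl)
    rw [h1, extD_apply hW hθ hc hus hu]
    exact congrArg (extDeriv (θ.inChart c) (c u)) (by rw [hSu, hJ])
  have hdA : (DForm.differential fun u => θ.eval u (S u)).eval u (verticalEndo n π u v) =
      fderiv ℝ (fun w => θ.inChart c w (fun _ => S.inChart c w)) (c u)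
        (verticalEndoCoord (c u).2 V) := by
    rw [differential_eval hW hA hc hus hu, hAc.fderiv_eq]
    exact congrArg _ hJ
  rw [poincareCartan_eval, hdA, hint, add_assoc, hmain, hθv, hθS, dtForm_eval hc hus]
  -- A semi-basic form depends only on the `(t, x)`-components, and `(τ, ξ) = τ (1, y) + (0, ξ - τ
  -- y)`. So `θ(V)` is `τ θ(S)` plus the value just found.
  have hlin : ∀ x y : JetModel n, ∀ r : ℝ, x.1 = (r • S.inChart c (c u) + y).1 →
      covectorField (θ.inChart c) (c u) x = r * covectorField (θ.inChart c) (c u)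
        (S.inChart c (c u)) + covectorField (θ.inChart c) (c u) y := by
    intro x y r hxy
    rw [← smul_eq_mul, ← map_smul, ← map_add, ← sub_eq_zero, ← map_sub]
    refine hsb'.self_of_nhds _ ?_
    rw [Prod.fst_sub, hxy, sub_self]
  have := hlin V ((0, (verticalEndoCoord (c u).2 V).2), 0) V.1.1 (by
    rw [Prod.fst_add, Prod.smul_fst, hS.inChart_fst hc hut, verticalEndoCoord_apply]
    ext <;> simp)
  rw [mul_comm]
  exact this

/-- For semi-basic `θ` one has `d_J θ = i_J dθ`. -/
lemma dJ_eq_insertion {θ : DForm (JetModel n) (J1 n π) 1} {W : Set (J1 n π)} (hW : IsOpen W)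
    (hsb : IsSemibasicOn θ W) {u : J1 n π} (hu : u ∈ W) :
    dJ θ u = DForm.insertion (verticalEndo n π) θ.extD u := by
  -- `J` has vertical values, so `i_J θ = 0` on `W`; locality of `d` removes the second term of `d_J
  -- θ`.
  have h : (DForm.insertion (verticalEndo n π) θ).extD u = (0 : DForm (JetModel n) (J1 n π) 1).extD u := by
    refine DForm.extD_congr hW (fun w hw => DForm.ext_one fun v => ?_) hu
    rw [DForm.insertion_one_eval, hsb.eval_verticalEndo hw]
    rfl
  rw [DForm.extD_zero] at h
  unfold dJ DForm.dEndo
  rw [Pi.sub_apply, h]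
  exact sub_zero _

/-- `d_J θ_L = 0`. -/
lemma dJ_poincareCartan {L : J1 n π → ℝ} {W : Set (J1 n π)} (hW : IsOpen W)
    (hL : ContMDiffOn 𝓘(ℝ, JetModel n) 𝓘(ℝ, ℝ) ∞ L W) {u : J1 n π} (hu : u ∈ W) :
    dJ (poincareCartan L) u = 0 := by
  rw [dJ_eq_insertion hW (isSemibasicOn_poincareCartan L W) hu]
  have hc := chart_mem_atlas (JetModel n) u
  have hus := mem_chart_source (JetModel n) u
  set c := chartAt (JetModel n) u
  have hut := c.map_source hus
  have huW : c.symm (c u) ∈ W := by rwa [c.left_inv hus]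
  have hsm := isSmoothOn_poincareCartan hW hL
  have hnhds : c.target ∩ c.symm ⁻¹' W ∈ 𝓝 (c u) :=
    (c.symm.isOpen_inter_preimage hW).mem_nhds ⟨hut, huW⟩
  have hl : ContDiffAt ℝ ∞ (L ∘ c.symm) (c u) := by
    have h := (DForm.isSmoothOn_ofFun hL).contDiffAt hW hc hut huW
    exact (ContinuousAlternatingMap.constOfIsEmptyLIE ℝ (JetModel n) ℝ
      (Fin 0)).symm.contDiff.contDiffAt.comp _ h
  -- The coordinate form of `θ_L` is needed on a neighbourhood, because it is about to be
  -- differentiated.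
  have hal : ∀ᶠ w in 𝓝 (c u), ∀ v : JetModel n,
      (poincareCartan L).inChart c w (fun _ => v) = (L ∘ c.symm) w * v.1.1 +
        fderiv ℝ (L ∘ c.symm) w (verticalEndoCoord w.2 v) := by
    filter_upwards [hnhds] with w hw v
    have hws := c.map_target hw.1
    have hv : (mfderiv 𝓘(ℝ, JetModel n) 𝓘(ℝ, JetModel n) c (c.symm w)
        (mfderiv 𝓘(ℝ, JetModel n) 𝓘(ℝ, JetModel n) c.symm w v) : JetModel n) = v :=
      mfderiv_mfderiv_symm_of_mem_atlas hc hw.1 v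
    have h1 : (poincareCartan L).inChart c w (fun _ => v) = (poincareCartan L).eval (c.symm w)
      (mfderiv 𝓘(ℝ, JetModel n) 𝓘(ℝ, JetModel n) c.symm w v) := rfl
    rw [h1, poincareCartan_eval, dtForm_eval hc hws, differential_eval hW hL hc hws hw.2,
      mfderiv_verticalEndo hc hws, c.right_inv hw.1]
    have key : ∀ x : JetModel n, x = v → L (c.symm w) * x.1.1 +
        fderiv ℝ (L ∘ c.symm) w (verticalEndoCoord w.2 x) = (L ∘ c.symm) w * v.1.1 +
          fderiv ℝ (L ∘ c.symm) w (verticalEndoCoord w.2 v) := by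
      rintro x rfl; rfl
    exact key _ hv
  -- `(i_J dθ_L)(v, w) = dθ_L(Jv, w) - dθ_L(Jw, v)`, which vanishes by the symmetry of `dθ_L(J·,
  -- ·)`.
  refine DForm.ext_two (η' := 0) fun v w => ?_
  rw [DForm.insertion_two_apply, DForm.two_swap _ u v, extD_apply hW hsm hc hus hu,
    extD_apply hW hsm hc hus hu, mfderiv_verticalEndo hc hus, mfderiv_verticalEndo hc hus]
  exact (congrArg (· + _) (extDeriv_poincareCartan_verticalEndoCoord
    ((hsm.contDiffAt hW hc hut huW).differentiableAt (by simp)) hl hal _ _)).trans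
      (add_neg_cancel _)

end JetForms

/-! ### The decomposition `θ = θ_L + f dt` and the two characterizations -/

section Decomposition

variable {n : ℕ} {M : Type*} [TopologicalSpace M]
  [ChartedSpace (EuclideanSpace ℝ (Fin (n + 1))) M] [IsManifold (𝓡 (n + 1)) ∞ M]
  {π : M → ℝ} [IsFibredOverReal n π]

lemma DForm.differential_add_eval {f g : J1 n π → ℝ} {W : Set (J1 n π)} (hW : IsOpen W)
    (hf : ContMDiffOn 𝓘(ℝ, JetModel n) 𝓘(ℝ, ℝ) ∞ f W)
    (hg : ContMDiffOn 𝓘(ℝ, JetModel n) 𝓘(ℝ, ℝ) ∞ g W) {u : J1 n π} (hu : u ∈ W)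
    (v : TangentSpace 𝓘(ℝ, JetModel n) u) :
    (DForm.differential (f + g) : DForm (JetModel n) (J1 n π) 1).eval u v =
      (DForm.differential f : DForm (JetModel n) (J1 n π) 1).eval u v +
        (DForm.differential g : DForm (JetModel n) (J1 n π) 1).eval u v := by
  have h := DForm.extD_add hW (DForm.isSmoothOn_ofFun hf) (DForm.isSmoothOn_ofFun hg) hu
  exact congrArg (fun η => η fun _ => v) h

lemma DForm.differential_zero :
    (DForm.differential (0 : J1 n π → ℝ) : DForm (JetModel n) (J1 n π) 1) = 0 :=
  DForm.extD_zero

lemma DForm.differential_neg_eval {g : J1 n π → ℝ} {W : Set (J1 n π)} (hW : IsOpen W)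
    (hg : ContMDiffOn 𝓘(ℝ, JetModel n) 𝓘(ℝ, ℝ) ∞ g W) {u : J1 n π} (hu : u ∈ W)
    (v : TangentSpace 𝓘(ℝ, JetModel n) u) :
    (DForm.differential (-g) : DForm (JetModel n) (J1 n π) 1).eval u v =
      -(DForm.differential g : DForm (JetModel n) (J1 n π) 1).eval u v := by
  have h := DForm.differential_add_eval (f := -g) hW hg.neg hg hu v
  have h0 : -g + g = 0 := neg_add_cancel g
  rw [h0, DForm.differential_zero] at h
  exact eq_neg_of_add_eq_zero_left h.symm

lemma DForm.lie_congr {S : VField (JetModel n) (J1 n π)} {k : ℕ}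
    {η η' : DForm (JetModel n) (J1 n π) (k + 1)} {W : Set (J1 n π)} (hW : IsOpen W)
    (h : ∀ u ∈ W, η u = η' u) {u : J1 n π} (hu : u ∈ W) :
    DForm.lie S η u = DForm.lie S η' u := by
  have h1 : (DForm.interior S η).extD u = (DForm.interior S η').extD u := by
    refine DForm.extD_congr hW (fun w hw => ?_) hu
    unfold DForm.interior
    rw [h w hw]
  have h2 : DForm.interior S η.extD u = DForm.interior S η'.extD u := by
    unfold DForm.interior
    rw [DForm.extD_congr hW h hu]
  unfold DForm.lie
  rw [Pi.add_apply, Pi.add_apply, h1, h2]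

lemma DForm.interior_eval (S : VField (JetModel n) (J1 n π))
    (η : DForm (JetModel n) (J1 n π) 2) (u : J1 n π) (v : TangentSpace 𝓘(ℝ, JetModel n) u) :
    (DForm.interior S η).eval u v = η u ![S u, v] :=
  congrArg (η u) (funext fun i => by fin_cases i <;> rfl)

lemma DForm.interior_eval_self (S : VField (JetModel n) (J1 n π))
    (η : DForm (JetModel n) (J1 n π) 2) (u : J1 n π) :
    (DForm.interior S η).eval u (S u) = 0 := by
  rw [DForm.interior_eval]
  exact (η u).map_eq_zero_of_eq _ (i := 0) (j := 1) rfl (by decide)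

lemma DForm.rankAt_congr {η η' : DForm (JetModel n) (J1 n π) 2} {u : J1 n π} (h : η u = η' u) :
    η.rankAt u = η'.rankAt u := by
  unfold DForm.rankAt
  rw [h]

/-- Every vertical vector is in the image of the vertical endomorphism. -/
lemma exists_verticalEndo_eq {u : J1 n π} {v : TangentSpace 𝓘(ℝ, JetModel n) u}
    (hv : mfderiv 𝓘(ℝ, JetModel n) (𝓡 (n + 1)) (J1.proj : J1 n π → M) u v = 0) :
    ∃ w, verticalEndo n π u w = v := by
  have hc := chart_mem_atlas (JetModel n) u
  have hu := mem_chart_source (JetModel n) u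
  set c := chartAt (JetModel n) u
  rw [mfderiv_proj_eq_zero_iff hc hu] at hv
  set V : JetModel n := mfderiv 𝓘(ℝ, JetModel n) 𝓘(ℝ, JetModel n) c u v with hV
  have hsurj : ∀ x : JetModel n, ∃ w : TangentSpace 𝓘(ℝ, JetModel n) u,
      (mfderiv 𝓘(ℝ, JetModel n) 𝓘(ℝ, JetModel n) c u w : JetModel n) = x := by
    intro x
    have key : ∀ (a b : J1 n π) (_ : a = b) (w : JetModel n),
        (mfderiv 𝓘(ℝ, JetModel n) 𝓘(ℝ, JetModel n) c a w : JetModel n) =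
          (mfderiv 𝓘(ℝ, JetModel n) 𝓘(ℝ, JetModel n) c b w : JetModel n) := by
      rintro a _ rfl w; rfl
    exact ⟨_, (key _ _ (c.left_inv hu).symm _).trans
      (mfderiv_mfderiv_symm_of_mem_atlas hc (c.map_source hu) x)⟩
  -- `J` sends `∂/∂xⁱ` to `∂/∂yⁱ`, so the preimage carries the fibre components of `v` in the
  -- `x`-directions.
  obtain ⟨w, hw⟩ := hsurj ((0, V.2), 0)
  refine ⟨w, ?_⟩
  rw [← sub_eq_zero]
  refine mfderiv_chart_injective hc hu ?_
  have h1 : (mfderiv 𝓘(ℝ, JetModel n) 𝓘(ℝ, JetModel n) c u (verticalEndo n π u w - v) : JetModel n)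
      = verticalEndoCoord (c u).2
        (mfderiv 𝓘(ℝ, JetModel n) 𝓘(ℝ, JetModel n) c u w : JetModel n) - V :=
    (map_sub (mfderiv 𝓘(ℝ, JetModel n) 𝓘(ℝ, JetModel n) c u) _ v).trans
      (congrArg (· - V) (mfderiv_verticalEndo hc hu w))
  refine h1.trans ?_
  have h2 : verticalEndoCoord (c u).2 ((0, V.2), 0) = V := by
    rw [verticalEndoCoord_apply]
    refine Prod.ext hv.symm ?_
    simp
  rw [hw, h2]
  exact sub_self V

/-- The contraction of `θ_L` with a semispray is `L`. -/
lemma interior_poincareCartan {S : VField (JetModel n) (J1 n π)} (hS : IsSemispray S)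
    (L : J1 n π → ℝ) : DForm.interior S (poincareCartan L) = DForm.ofFun L := by
  rw [DForm.interior_eq_ofFun]
  congr 1
  funext u
  rw [poincareCartan_eval, hS.time, hS.vertical, DForm.eval_map_zero]
  ring

/-- As `θ_L(S) = L`, this turns the Lagrangian condition `L_S θ_L = dL` into `i_S dθ_L = 0`. -/
lemma lie_poincareCartan {S : VField (JetModel n) (J1 n π)} (hS : IsSemispray S)
    (L : J1 n π → ℝ) (u : J1 n π) : DForm.lie S (poincareCartan L) u =
      DForm.differential L u + DForm.interior S (poincareCartan L).extD u := by
  unfold DForm.lie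
  rw [interior_poincareCartan hS]
  rfl

/-- A closed semi-basic `1`-form that vanishes on a semispray is zero. -/
lemma eval_eq_zero_of_closed_semibasic {S : VField (JetModel n) (J1 n π)} (hS : IsSemispray S)
    {α : DForm (JetModel n) (J1 n π) 1} {W : Set (J1 n π)} (hW : IsOpen W)
    (hα : α.IsSmoothOn W) (hclosed : ∀ u ∈ W, α.extD u = 0) (hsb : IsSemibasicOn α W)
    (hαS : ∀ u ∈ W, α.eval u (S u) = 0) {u : J1 n π} (hu : u ∈ W)
    (v : TangentSpace 𝓘(ℝ, JetModel n) u) : α.eval u v = 0 := by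
  -- `α(S)` is known to vanish on `W` only, hence the appeal to locality of `d`.
  have hd : (DForm.differential fun u => α.eval u (S u)) u =
      (DForm.differential (0 : J1 n π → ℝ) : DForm (JetModel n) (J1 n π) 1) u := by
    refine DForm.extD_congr hW (fun w hw => ?_) hu
    exact congrArg (ContinuousAlternatingMap.constOfIsEmpty ℝ
      (TangentSpace 𝓘(ℝ, JetModel n) w) (Fin 0)) (hαS w hw)
  have hd' : (DForm.differential fun u => α.eval u (S u)).eval u (verticalEndo n π u v) = 0 := by
    unfold DForm.eval at hd ⊢
    rw [hd, DForm.differential_zero]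
    rfl
  -- In `α = α(S) dt + d(α(S)) ∘ J + (i_S dα) ∘ J` all three terms vanish: the first two because
  -- `α(S) = 0`, the last because `dα = 0`.
  rw [semibasic_eval_eq hS hW hα hsb hu, poincareCartan_eval, hαS u hu, hd', DForm.interior_eval,
    hclosed u hu, zero_mul, zero_add, zero_add]
  rfl

lemma LambdaS_mono {S : VField (JetModel n) (J1 n π)} {W W' : Set (J1 n π)} (h : W' ⊆ W) :
    LambdaS S W ⊆ LambdaS S W' := fun _ ⟨h1, h2, h3, h4⟩ =>
  ⟨h1.mono h, fun u hu => h2 u (h hu), fun u hu => h3 u (h hu), fun u hu => h4 u (h hu)⟩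

/-- For `θ ∈ Λ¹_S(W)` the form `i_S dθ` is closed. -/
lemma extD_interior_extD_eq_zero {S : VField (JetModel n) (J1 n π)}
    {θ : DForm (JetModel n) (J1 n π) 1} {W : Set (J1 n π)} (hW : IsOpen W)
    (hθ : θ ∈ LambdaS S W) {u : J1 n π} (hu : u ∈ W) :
    (DForm.interior S θ.extD).extD u = 0 := by
  have h := hθ.2.2.2 u hu
  -- `L_S dθ = d(i_S dθ) + i_S(d dθ)`, and the second summand is zero.
  have h0 : DForm.interior S θ.extD.extD u = 0 := by
    unfold DForm.interior
    rw [DForm.extD_extD hW hθ.1 hu]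
    rfl
  unfold DForm.lie at h
  rw [Pi.add_apply, h0] at h
  exact (add_zero _).symm.trans h

/-- The decomposition `θ = θ_L + f dt`, given a primitive `g` of `i_S dθ`. -/
lemma exists_decomposition {S : VField (JetModel n) (J1 n π)} (hS : IsSemispray S)
    {θ : DForm (JetModel n) (J1 n π) 1} {W : Set (J1 n π)} (hW : IsOpen W)
    (hθ : θ ∈ LambdaS S W) {g : J1 n π → ℝ}
    (hg : ContMDiffOn 𝓘(ℝ, JetModel n) 𝓘(ℝ, ℝ) ∞ g W)
    (hdg : ∀ u ∈ W, DForm.interior S θ.extD u = DForm.differential g u) :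
    ∃ L, IsLagrangianFor S L W ∧ IsFirstIntegralOn S (-g) W ∧
      ∀ u ∈ W, θ u = (poincareCartan L + smulDt (-g) : DForm (JetModel n) (J1 n π) 1) u := by
  obtain ⟨hsm, hsb, hnd, -⟩ := hθ
  have hA : ContMDiffOn 𝓘(ℝ, JetModel n) 𝓘(ℝ, ℝ) ∞ (fun u => θ.eval u (S u)) W := by
    refine DForm.contMDiffOn_of_isSmoothOn_ofFun hW ?_
    rw [← DForm.interior_eq_ofFun]
    exact hsm.interior hS.smooth
  have hdg' : ∀ u ∈ W, ∀ v, (DForm.interior S θ.extD).eval u v =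
      (DForm.differential g : DForm (JetModel n) (J1 n π) 1).eval u v := fun u hu v =>
    congrArg (fun η => η fun _ => v) (hdg u hu)
  -- With `A = θ(S)`, replacing `i_S dθ` by `dg` gives `θ = A dt + d_J A + d_J g = θ_(A + g) - g
  -- dt`, which dictates this choice.
  set L : J1 n π → ℝ := (fun u => θ.eval u (S u)) + g with hL
  have hLs : ContMDiffOn 𝓘(ℝ, JetModel n) 𝓘(ℝ, ℝ) ∞ L W := hA.add hg
  have hdec : ∀ u ∈ W, poincareCartan L u = (θ + smulDt g) u := by
    intro u hu
    refine DForm.ext_one fun v => ?_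
    rw [DForm.eval_add, smulDt_eval, semibasic_eval_eq hS hW hsm hsb hu, poincareCartan_eval,
      poincareCartan_eval, hdg' u hu, DForm.differential_add_eval hW hA hg hu, hL, Pi.add_apply]
    ring
  -- Because `d(g dt) = dg ∧ dt = i_S dθ ∧ dt`, the form whose rank defines non-degeneracy is
  -- exactly `dθ_L`.
  have hext : ∀ u ∈ W, (poincareCartan L).extD u =
      (θ.extD + (DForm.interior S θ.extD).wedge (dtForm n π)) u := by
    intro u hu
    rw [DForm.extD_congr hW hdec hu, DForm.extD_add hW hsm (isSmoothOn_smulDt hg) hu,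
      extD_smulDt hW hg hu, Pi.add_apply]
    unfold DForm.wedge
    rw [hdg u hu]
  refine ⟨L, ⟨⟨hLs, fun u hu => ?_⟩, fun u hu => ?_⟩, ⟨hg.neg, fun u hu => ?_⟩, fun u hu => ?_⟩
  · rw [DForm.rankAt_congr (hext u hu)]
    exact hnd u hu
  · rw [lie_poincareCartan hS]
    -- With `ω = i_S dθ`, contraction gives `ω + ω(S) dt - dt(S) ω = 0`, as `ω(S) = 0` and `dt(S) =
    -- 1`.
    have h0 : DForm.interior S (poincareCartan L).extD u =
        (0 : DForm (JetModel n) (J1 n π) 1) u := by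
      refine DForm.ext_one fun v => ?_
      rw [DForm.interior_eval, hext u hu]
      refine (congrArg (θ.extD u ![S u, v] + ·) (DForm.wedge_apply _ _ u (S u) v)).trans ?_
      rw [DForm.interior_eval_self, hS.time, ← DForm.interior_eval]
      have : (0 : DForm (JetModel n) (J1 n π) 1).eval u v = 0 := rfl
      rw [this]
      ring
    rw [h0]
    exact add_zero _
  -- `S(g) = dθ(S, S) = 0` by antisymmetry.
  · rw [DForm.differential_neg_eval hW hg hu, ← hdg' u hu, DForm.interior_eval_self, neg_zero]
  · refine DForm.ext_one fun v => ?_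
    have h := congrArg (fun η => η fun _ => v) (hdec u hu)
    have h' : (poincareCartan L).eval u v = θ.eval u v + (smulDt g).eval u v := h
    rw [DForm.eval_add, h', smulDt_eval, smulDt_eval, Pi.neg_apply]
    ring

/-- A regular Lagrangian `L` for `S` and a first integral `f` give `θ_L + f dt ∈ Λ¹_S(W)`. -/
lemma poincareCartan_add_smulDt_mem {S : VField (JetModel n) (J1 n π)} (hS : IsSemispray S)
    {W : Set (J1 n π)} (hW : IsOpen W) {L f : J1 n π → ℝ} (hL : IsLagrangianFor S L W)
    (hf : IsFirstIntegralOn S f W) :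
    (poincareCartan L + smulDt f ∈ LambdaS S W) ∧
      ∀ u ∈ W, DForm.interior S (poincareCartan L + smulDt f).extD u =
        DForm.differential (-f) u := by
  obtain ⟨⟨hLs, hrank⟩, hlie⟩ := hL
  obtain ⟨hfs, hfS⟩ := hf
  have hsm := (isSmoothOn_poincareCartan hW hLs).add (isSmoothOn_smulDt hfs)
  have hext : ∀ u ∈ W, (poincareCartan L + smulDt f).extD u =
      ((poincareCartan L).extD + (DForm.differential f).wedge (dtForm n π)) u := fun u hu => by
    rw [DForm.extD_add hW (isSmoothOn_poincareCartan hW hLs) (isSmoothOn_smulDt hfs) hu,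
      extD_smulDt hW hfs hu, Pi.add_apply]
  -- The Lagrangian condition in the form `i_S dθ_L = 0`.
  have hint : ∀ u ∈ W, ∀ v, (poincareCartan L).extD u ![S u, v] = 0 := fun u hu v => by
    have h := hlie u hu
    rw [lie_poincareCartan hS] at h
    have h1 := add_eq_left.1 h
    rw [← DForm.interior_eval]
    exact congrArg (fun η => η fun _ => v) h1
  -- `i_S (df ∧ dt) = S(f) dt - df`, and `S(f) = 0`.
  have hω : ∀ u ∈ W, DForm.interior S (poincareCartan L + smulDt f).extD u =
      DForm.differential (-f) u := by
    intro u hu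
    refine DForm.ext_one fun v => ?_
    rw [DForm.interior_eval, hext u hu, DForm.differential_neg_eval hW hfs hu]
    refine (congrArg₂ (· + ·) (hint u hu v) (DForm.wedge_apply _ _ u (S u) v)).trans ?_
    rw [hfS u hu, hS.time]
    ring
  refine ⟨⟨hsm, (isSemibasicOn_poincareCartan L W).add (isSemibasicOn_smulDt f W),
    fun u hu => ?_, fun u hu => ?_⟩, hω⟩
  -- The contributions `df ∧ dt` and `-df ∧ dt` cancel, so the form to be tested is again `dθ_L`.
  · rw [← hrank u hu]
    refine DForm.rankAt_congr (DForm.ext_two fun v w => ?_)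
    have hωv : ∀ x, (DForm.interior S (poincareCartan L + smulDt f).extD).eval u x =
        -(DForm.differential f : DForm (JetModel n) (J1 n π) 1).eval u x := fun x =>
      (congrArg (fun η => η fun _ => x) (hω u hu)).trans
        (DForm.differential_neg_eval hW hfs hu x)
    have h1 : (poincareCartan L + smulDt f).extD u ![v, w] =
        (poincareCartan L).extD u ![v, w] +
          (DForm.differential f).wedge (dtForm n π) u ![v, w] :=
      congrArg (fun η => η ![v, w]) (hext u hu)
    refine (congrArg₂ (· + ·) h1 (DForm.wedge_apply _ _ u v w)).trans ?_
    rw [DForm.wedge_apply, hωv, hωv]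
    ring
  · have h1 : DForm.interior S (poincareCartan L + smulDt f).extD.extD u = 0 := by
      unfold DForm.interior
      rw [DForm.extD_extD hW hsm hu]
      rfl
    unfold DForm.lie
    rw [Pi.add_apply, h1, DForm.extD_congr hW hω hu]
    have h2 : (DForm.differential (-f) : DForm (JetModel n) (J1 n π) 1).extD u = 0 :=
      DForm.extD_extD hW (DForm.isSmoothOn_ofFun hfs.neg) hu
    rw [h2]
    exact add_zero _

/-- For `θ ∈ Λ¹_S(W)`, the form `d_J θ` vanishes if and only if `i_S dθ` does. -/
lemma dJ_eq_zero_iff {S : VField (JetModel n) (J1 n π)} (hS : IsSemispray S)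
    {θ : DForm (JetModel n) (J1 n π) 1} {W : Set (J1 n π)} (hW : IsOpen W)
    (hθ : θ ∈ LambdaS S W) :
    (∀ u ∈ W, dJ θ u = 0) ↔ ∀ u ∈ W, DForm.interior S θ.extD u = 0 := by
  have hsm := hθ.1
  have hsb := hθ.2.1
  constructor
  · intro h u hu
    -- `i_S dθ` is closed and kills `S`. Once it is seen to be semi-basic, it vanishes.
    refine DForm.ext_one (θ' := 0) fun v => ?_
    refine eval_eq_zero_of_closed_semibasic hS hW ((hsm.extD hW).interior hS.smooth)
      (fun w hw => extD_interior_extD_eq_zero hW hθ hw) ?_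
      (fun w _ => DForm.interior_eval_self S θ.extD w) hu v
    intro w hw x hx
    obtain ⟨y, rfl⟩ := exists_verticalEndo_eq hx
    have h1 := h w hw
    rw [dJ_eq_insertion hW hsb hw] at h1
    -- Inserting `S` in `i_J dθ = 0` leaves `dθ(S, Jy) = 0`, since `JS = 0`; every vertical vector
    -- is such a `Jy`.
    have h2 := congrArg (fun η => η ![S w, y]) h1
    have h3 := (DForm.insertion_two_apply (verticalEndo n π) θ.extD w (S w) y).symm.trans h2
    have h4 : θ.extD w ![verticalEndo n π w (S w), y] = 0 := by
      rw [hS.vertical]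
      exact (θ.extD w).map_coord_zero 0 rfl
    rw [h4, zero_add] at h3
    rw [DForm.interior_eval]
    exact h3
  · intro h u hu
    -- Without the `i_S dθ` term, `θ` is the Poincaré-Cartan form of `θ(S)`, whose `d_J` is zero.
    have hdec : ∀ w ∈ W, θ w = poincareCartan (fun u => θ.eval u (S u)) w := by
      intro w hw
      refine DForm.ext_one fun v => ?_
      have h0 : (DForm.interior S θ.extD).eval w (verticalEndo n π w v) = 0 :=
        congrArg (fun η => η fun _ => verticalEndo n π w v) (h w hw)
      rw [semibasic_eval_eq hS hW hsm hsb hw, h0, add_zero]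
    have hA : ContMDiffOn 𝓘(ℝ, JetModel n) 𝓘(ℝ, ℝ) ∞ (fun u => θ.eval u (S u)) W := by
      refine DForm.contMDiffOn_of_isSmoothOn_ofFun hW ?_
      rw [← DForm.interior_eq_ofFun]
      exact hsm.interior hS.smooth
    rw [← dJ_poincareCartan hW hA hu, dJ_eq_insertion hW hsb hu,
      dJ_eq_insertion hW (isSemibasicOn_poincareCartan _ W) hu]
    unfold DForm.insertion
    rw [DForm.extD_congr hW hdec hu]

lemma differential_neg_eq_zero_iff {g : J1 n π → ℝ} {W : Set (J1 n π)} (hW : IsOpen W)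
    (hg : ContMDiffOn 𝓘(ℝ, JetModel n) 𝓘(ℝ, ℝ) ∞ g W) {u : J1 n π} (hu : u ∈ W) :
    (DForm.differential (-g) : DForm (JetModel n) (J1 n π) 1) u = 0 ↔
      (DForm.differential g : DForm (JetModel n) (J1 n π) 1) u = 0 := by
  constructor <;> intro h <;> refine DForm.ext_one (θ' := 0) fun v => ?_
  · have h1 := DForm.differential_neg_eval hW hg hu v
    have h2 : (DForm.differential (-g) : DForm (JetModel n) (J1 n π) 1).eval u v = 0 :=
      congrArg (fun η => η fun _ => v) h
    exact neg_eq_zero.1 (h1.symm.trans h2)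
  · have h1 := DForm.differential_neg_eval hW hg hu v
    have h2 : (DForm.differential g : DForm (JetModel n) (J1 n π) 1).eval u v = 0 :=
      congrArg (fun η => η fun _ => v) h
    exact h1.trans (neg_eq_zero.2 h2)

/-- For a primitive `g` of `i_S dθ`, `d_J θ` vanishes identically if and only if `dg` does. -/
lemma exists_dJ_ne_zero_iff {S : VField (JetModel n) (J1 n π)} (hS : IsSemispray S)
    {θ : DForm (JetModel n) (J1 n π) 1} {W : Set (J1 n π)} (hW : IsOpen W)
    (hθ : θ ∈ LambdaS S W) {g : J1 n π → ℝ}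
    (hdg : ∀ u ∈ W, DForm.interior S θ.extD u = DForm.differential g u) :
    (∃ u ∈ W, dJ θ u ≠ 0) ↔
      ∃ u ∈ W, (DForm.differential g : DForm (JetModel n) (J1 n π) 1) u ≠ 0 := by
  have h := dJ_eq_zero_iff hS hW hθ
  have h' : (∀ u ∈ W, DForm.interior S θ.extD u = 0) ↔
      ∀ u ∈ W, (DForm.differential g : DForm (JetModel n) (J1 n π) 1) u = 0 :=
    forall₂_congr fun u hu => by rw [hdg u hu]
  have h2 := not_congr (h.trans h')
  push Not at h2
  exact h2

/-- The equivalence of vanishing relies on closedness and holds on open sets rather than at single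
points. It is therefore applied to `U ∩ W` for each open neighbourhood `U` of `u`. -/
lemma frequently_dJ_ne_zero_iff {S : VField (JetModel n) (J1 n π)} (hS : IsSemispray S)
    {θ : DForm (JetModel n) (J1 n π) 1} {W : Set (J1 n π)} (hW : IsOpen W)
    (hθ : θ ∈ LambdaS S W) {g : J1 n π → ℝ}
    (hdg : ∀ u ∈ W, DForm.interior S θ.extD u = DForm.differential g u) {u : J1 n π}
    (hu : u ∈ W) :
    (∃ᶠ v in 𝓝 u, dJ θ v ≠ 0) ↔
      ∃ᶠ v in 𝓝 u, (DForm.differential g : DForm (JetModel n) (J1 n π) 1) v ≠ 0 := by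
  have key : ∀ V : Set (J1 n π), IsOpen V → V ⊆ W → ((∃ v ∈ V, dJ θ v ≠ 0) ↔
      ∃ v ∈ V, (DForm.differential g : DForm (JetModel n) (J1 n π) 1) v ≠ 0) := fun V hV hVW =>
    exists_dJ_ne_zero_iff hS hV (LambdaS_mono hVW hθ) fun v hv => hdg v (hVW hv)
  rw [frequently_nhds_iff, frequently_nhds_iff]
  constructor <;> intro h U hUu hU
  · obtain ⟨v, hv, h1⟩ := (key _ (hU.inter hW) inter_subset_right).1 (by
      obtain ⟨v, hv, h1⟩ := h (U := U ∩ W) ⟨hUu, hu⟩ (hU.inter hW)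
      exact ⟨v, hv, h1⟩)
    exact ⟨v, hv.1, h1⟩
  · obtain ⟨v, hv, h1⟩ := (key _ (hU.inter hW) inter_subset_right).2 (by
      obtain ⟨v, hv, h1⟩ := h (U := U ∩ W) ⟨hUu, hu⟩ (hU.inter hW)
      exact ⟨v, hv, h1⟩)
    exact ⟨v, hv.1, h1⟩

lemma hasLagrangianDecompositionOn_of_primitive {S : VField (JetModel n) (J1 n π)}
    (hS : IsSemispray S) {θ : DForm (JetModel n) (J1 n π) 1} {W : Set (J1 n π)} (hW : IsOpen W)
    (hθ : θ ∈ LambdaS S W) {g : J1 n π → ℝ}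
    (hg : ContMDiffOn 𝓘(ℝ, JetModel n) 𝓘(ℝ, ℝ) ∞ g W)
    (hdg : ∀ u ∈ W, DForm.interior S θ.extD u = DForm.differential g u) :
    HasLagrangianDecompositionOn S θ W := by
  obtain ⟨L, hL, hf, hdec⟩ := exists_decomposition hS hW hθ hg hdg
  refine ⟨L, -g, hL, hf, hdec, fun h => ?_⟩
  obtain ⟨u, hu, h1⟩ := (exists_dJ_ne_zero_iff hS hW hθ hdg).1 h
  exact ⟨u, hu, fun h0 => h1 ((differential_neg_eq_zero_iff hW hg hu).1 h0)⟩

/-- A form `θ ∈ Λ¹_S(W)` with `d_J θ = 0` is the Poincaré-Cartan form of a regular Lagrangian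
for `S`. -/
lemma exists_lagrangian_of_dJ_eq_zero {S : VField (JetModel n) (J1 n π)} (hS : IsSemispray S)
    {θ : DForm (JetModel n) (J1 n π) 1} {W : Set (J1 n π)} (hW : IsOpen W)
    (hθ : θ ∈ LambdaS S W) (h : ∀ v ∈ W, dJ θ v = 0) :
    ∃ L, IsLagrangianFor S L W ∧ ∀ v ∈ W, θ v = poincareCartan L v := by
  -- Here `i_S dθ = 0`, so `g = 0` is a primitive on all of `W` and the Lagrangian `θ(S)` is global.
  obtain ⟨L, hL, -, hdec⟩ := exists_decomposition hS hW hθ (g := 0) contMDiffOn_const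
    fun u hu => by
      rw [(dJ_eq_zero_iff hS hW hθ).1 h u hu, DForm.differential_zero]
      rfl
  refine ⟨L, hL, fun v hv => (hdec v hv).trans (DForm.ext_one fun x => ?_)⟩
  rw [DForm.eval_add, smulDt_eval]
  simp

lemma isFirstIntegralOn_zero (S : VField (JetModel n) (J1 n π)) (W : Set (J1 n π)) :
    IsFirstIntegralOn S 0 W := by
  refine ⟨contMDiffOn_const, fun u _ => ?_⟩
  rw [DForm.differential_zero]
  rfl

/-- Forwards, `θ_L + 0 dt` is the required form: its contraction `i_S dθ` is the differential of
zero, so `d_J θ = 0`. -/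
lemma isLagrangianOn_iff {S : VField (JetModel n) (J1 n π)} (hS : IsSemispray S)
    {W : Set (J1 n π)} (hW : IsOpen W) :
    IsLagrangianOn S W ↔ ∃ θ ∈ LambdaS S W, ∀ v ∈ W, dJ θ v = 0 := by
  constructor
  · rintro ⟨L, hL⟩
    obtain ⟨h1, h2⟩ := poincareCartan_add_smulDt_mem hS hW hL (isFirstIntegralOn_zero S W)
    refine ⟨_, h1, (dJ_eq_zero_iff hS hW h1).2 fun u hu => ?_⟩
    rw [h2 u hu, neg_zero, DForm.differential_zero]
    rfl
  · rintro ⟨θ, hθ, h⟩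
    obtain ⟨L, hL, -⟩ := exists_lagrangian_of_dJ_eq_zero hS hW hθ h
    exact ⟨L, hL⟩

/-- For `θ = θ_L + f dt` the function `-f` is a primitive of `i_S dθ`, so `df ≢ 0` transfers to `d_J
θ ≢ 0`. -/
lemma IsConservativeLagrangianOn.exists_form {S : VField (JetModel n) (J1 n π)}
    (hS : IsSemispray S) {W : Set (J1 n π)} (hW : IsOpen W)
    (h : IsConservativeLagrangianOn S W) : ∃ θ ∈ LambdaS S W, ∃ v ∈ W, dJ θ v ≠ 0 := by
  obtain ⟨L, f, hL, hf, u, hu, hdf⟩ := h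
  obtain ⟨h1, h2⟩ := poincareCartan_add_smulDt_mem hS hW hL hf
  refine ⟨_, h1, (exists_dJ_ne_zero_iff hS hW h1 h2).2 ⟨u, hu, fun h0 => hdf ?_⟩⟩
  exact (differential_neg_eq_zero_iff hW hf.1 hu).1 h0

/-- The converse passes to the smaller neighbourhood given by the Poincaré lemma. Non-vanishing
arbitrarily close to `u` survives this shrinking, whereas non-vanishing somewhere on `W` might not.
-/
lemma isConservativeLagrangian_iff {S : VField (JetModel n) (J1 n π)} (hS : IsSemispray S) :
    IsConservativeLagrangian S ↔
      ∀ u : J1 n π, ∃ W : Set (J1 n π), IsOpen W ∧ u ∈ W ∧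
        ∃ θ ∈ LambdaS S W, ∃ᶠ v in 𝓝 u, dJ θ v ≠ 0 := by
  refine forall_congr' fun u => ⟨?_, ?_⟩
  · rintro ⟨W, hW, hu, L, f, hL, hf, hdf⟩
    obtain ⟨h1, h2⟩ := poincareCartan_add_smulDt_mem hS hW hL hf
    refine ⟨W, hW, hu, _, h1, (frequently_dJ_ne_zero_iff hS hW h1 h2 hu).2 ?_⟩
    refine (hdf.and_eventually (hW.mem_nhds hu)).mono fun v hv h0 => hv.1 ?_
    exact (differential_neg_eq_zero_iff hW hf.1 hv.2).1 h0
  · rintro ⟨W, hW, hu, θ, hθ, hdJ⟩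
    obtain ⟨W', hW', hu', hsub, g, hg, hdg⟩ := DForm.exists_local_primitive hW
      ((hθ.1.extD hW).interior hS.smooth) (fun w hw => extD_interior_extD_eq_zero hW hθ hw) hu
    have hθ' := LambdaS_mono hsub hθ
    obtain ⟨L, hL, hf, -⟩ := exists_decomposition hS hW' hθ' hg hdg
    refine ⟨W', hW', hu', L, -g, hL, hf, ?_⟩
    refine (((frequently_dJ_ne_zero_iff hS hW' hθ' hdg hu').1 hdJ).and_eventually
      (hW'.mem_nhds hu')).mono fun v hv h0 => hv.1 ?_
    exact (differential_neg_eq_zero_iff hW' hg hv.2).1 h0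

end Decomposition

/-! ### Assembly of the local and global statements -/

theorem proposition4p6 {n : ℕ} {M : Type*} [TopologicalSpace M]
    [ChartedSpace (EuclideanSpace ℝ (Fin (n + 1))) M] [IsManifold (𝓡 (n + 1)) ∞ M]
    (π : M → ℝ) [IsFibredOverReal n π]
    (S : VField (JetModel n) (J1 n π)) (hS : IsSemispray S) :
    -- (i), around every point
    (IsLagrangian S ↔
      ∀ u : J1 n π, ∃ W : Set (J1 n π), IsOpen W ∧ u ∈ W ∧
        ∃ θ ∈ LambdaS S W, ∀ v ∈ W, dJ θ v = 0) ∧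
    -- (i), on any given open set, in particular on the whole jet bundle
    (∀ W : Set (J1 n π), IsOpen W →
      (IsLagrangianOn S W ↔ ∃ θ ∈ LambdaS S W, ∀ v ∈ W, dJ θ v = 0)) ∧
    (∀ W : Set (J1 n π), IsOpen W → ∀ θ ∈ LambdaS S W, (∀ v ∈ W, dJ θ v = 0) →
      ∃ L : J1 n π → ℝ, IsRegularLagrangianOn L W ∧
        (∀ v ∈ W, θ v = poincareCartan L v) ∧
        (∀ v ∈ W, DForm.lie S θ v = DForm.differential L v)) ∧
    -- (ii), around every point
    (IsConservativeLagrangian S ↔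
      ∀ u : J1 n π, ∃ W : Set (J1 n π), IsOpen W ∧ u ∈ W ∧
        ∃ θ ∈ LambdaS S W, ∃ᶠ v in 𝓝 u, dJ θ v ≠ 0) ∧
    -- (ii), on any given open set
    (∀ W : Set (J1 n π), IsOpen W → IsConservativeLagrangianOn S W →
      ∃ θ ∈ LambdaS S W, ∃ v ∈ W, dJ θ v ≠ 0) ∧
    (∀ W : Set (J1 n π), IsOpen W → ClosedOneFormsExactOn (JetModel n) W →
      (IsConservativeLagrangianOn S W ↔ ∃ θ ∈ LambdaS S W, ∃ v ∈ W, dJ θ v ≠ 0)) ∧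
    (∀ W : Set (J1 n π), IsOpen W → ∀ θ ∈ LambdaS S W, (∃ v ∈ W, dJ θ v ≠ 0) →
      (∀ u ∈ W, ∃ W' : Set (J1 n π), IsOpen W' ∧ u ∈ W' ∧ W' ⊆ W ∧
        HasLagrangianDecompositionOn S θ W') ∧
      (ClosedOneFormsExactOn (JetModel n) W → HasLagrangianDecompositionOn S θ W)) := by
  -- Exactness is needed for one closed form only, `i_S dθ`; its primitive lives on all of `W`, and
  -- so does the decomposition.
  have hglobal : ∀ W : Set (J1 n π), IsOpen W → ClosedOneFormsExactOn (JetModel n) W →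
      ∀ θ ∈ LambdaS S W, HasLagrangianDecompositionOn S θ W := by
    intro W hW hex θ hθ
    obtain ⟨g, hg, hdg⟩ := hex _ ((hθ.1.extD hW).interior hS.smooth)
      fun w hw => extD_interior_extD_eq_zero hW hθ hw
    exact hasLagrangianDecompositionOn_of_primitive hS hW hθ hg hdg
  refine ⟨?_, fun W hW => isLagrangianOn_iff hS hW, ?_, isConservativeLagrangian_iff hS,
    fun W hW h => h.exists_form hS hW, ?_, ?_⟩
  · refine forall_congr' fun u => exists_congr fun W => and_congr_right fun hW =>
      and_congr_right fun _ => isLagrangianOn_iff hS hW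
  · intro W hW θ hθ h
    obtain ⟨L, hL, hdec⟩ := exists_lagrangian_of_dJ_eq_zero hS hW hθ h
    -- `θ` and `θ_L` agree on the open set `W`, hence so do their Lie derivatives there.
    exact ⟨L, hL.1, hdec, fun v hv => (DForm.lie_congr hW hdec hv).trans (hL.2 v hv)⟩
  · refine fun W hW hex => ⟨fun h => h.exists_form hS hW, ?_⟩
    rintro ⟨θ, hθ, h⟩
    obtain ⟨L, f, hL, hf, -, hdf⟩ := hglobal W hW hex θ hθ
    exact ⟨L, f, hL, hf, hdf h⟩
  · refine fun W hW θ hθ _ => ⟨fun u hu => ?_, fun hex => hglobal W hW hex θ hθ⟩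
    obtain ⟨W', hW', hu', hsub, g, hg, hdg⟩ := DForm.exists_local_primitive hW
      ((hθ.1.extD hW).interior hS.smooth) (fun w hw => extD_interior_extD_eq_zero hW hθ hw) hu
    exact ⟨W', hW', hu', hsub,
      hasLagrangianDecompositionOn_of_primitive hS hW' (LambdaS_mono hsub hθ) hg hdg⟩
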